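/- A weighted directed hypergraph $H=(V,E,w)$ has hyperedges $e$ with nonempty tail $t(e)\subseteq V$, nonempty head $h(e)\subseteq V$ and weight $w(e)\ge 0$; parallel hyperedges are allowed, and its rank is $r=\max_e|t(e)\cup h(e)|$. Its energy at $x\in\mathbb R^V$ is $Q_H(x)=\sum_{e}w(e)\max_{u\in t(e),\,v\in h(e)}\max(x_u-x_v,0)^2$. A hypergraph $G$ on $V$ is a $(1\pm\varepsilon)$-spectral hypersparsifier of $H$ if $(1-\varepsilon)Q_H(x)\le Q_G(x)\le(1+\varepsilon)Q_H(x)$ for all $x\in\mathbb R^V$. For $u,v\in V$ let $E_{u,v}$ be the set of present hyperedges $e$ with $u\in t(e)$ and $v\in h(e)$. The data structure Decremental-Coreset-And-Sample with parameter $\lambda$ works as follows. Initialization: build every $E_{u,v}$, ordered from highest to lowest weight; go through the pairs $(u,v)$ with $E_{u,v}\neq\emptyset$ in some order and for each move the $\lambda$ heaviest hyperedges of $E_{u,v}\setminus C$ (all of them if there are fewer) to the coreset $C$, which is empty at first; then put each hyperedge outside $C$ into the sample $S$ independently with probability $1/2$. Deletion of $e$: if $e\in C$ and $e$ was added to $C$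 from $E_{u,v}$, add a heaviest hyperedge of $E_{u,v}\setminus C$ (if there is one) to $C$, remove that hyperedge from $S$, and remove $e$ from $C$; then remove $e$ from all sets $E_{u,v}$ and from $S$. Ties and orders are resolved by a fixed rule that does not depend on the coins. $C\cup S$ denotes the hypergraph in which hyperedges in $C$ keep their weight and hyperedges in $S$ have twice their weight. Time is the number of elementary steps of an explicit implementation, where inspecting a list, one round of a loop, comparing two weights, reading or writing one cell of an (initially blank) random-access table, and tossing a coin cost one step each. Lemma. For every real $c\ge 2$ there are constants $\kappa,K>0$ depending only on $c$ such that the following holds. Let $H$ be a directed hypergraph with $n$ vertices, $m\ge 2$ hyperedges and rank $r$, with $m\ge c\log m$ (natural logarithm), let $0<\varepsilon<1$ and $\lambda=\lceil\kappa\,\varepsilon^{-2}\log^3 m\rceil$. Let a sequence of deletions of distinct hyperedges of $H$ be fixed independently of the coins, and let $H_t$, $C_t$, $S_t$ be the hypergraph, the coreset and the sample after the first $t$ deletions ($t\ge 0$). Then: 1. For every outcome of the coins and every $t$, $C_t$ is a coreset of $H_t$, that is, the disjoint union of sets $D_{u,v}\subseteq E_{u,v}$ with $|D_{u,v}|\le\lambda$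 such that whenever some $e\in E_{u,v}\setminus C_t$ exists, $|D_{u,v}|=\lambda$ and every member of $D_{u,v}$ is at least as heavy as $e$; and $S_t$ consists of the hyperedges of $H_t$ outside $C_t$ whose coin shows success. 2. For every outcome of the coins, the total time of the initialization and of all deletions, divided by $m$, is at most $K\,r^2\log m$, i.e. the amortized update time is $O(r^2\log m)$. 3. With probability at least $1-1/m^{c-1}$, simultaneously for all $t$, $C_t\cup S_t$ is a $(1\pm\varepsilon)$-spectral hypersparsifier of $H_t$ and has at most $\frac m2+(2cm\log m)^{1/2}+K\,\frac{n^2}{\varepsilon^2}\log^3 m$ hyperedges. -/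

import Mathlib

open MeasureTheory Finset

/-! ### Directed hypergraphs, energy, spectral hypersparsifiers -/

/-- A weighted directed hypergraph on the vertex set `V`. The hyperedges carry labels from `E`
(so parallel hyperedges are allowed), and `edges` is the set of hyperedges that are present. -/
structure DirHypergraph (V E : Type*) where
  edges : Finset E
  tail : E → Finset V
  head : E → Finset V
  weight : E → ℝ
  tail_nonempty : ∀ e, (tail e).Nonempty
  head_nonempty : ∀ e, (head e).Nonempty
  weight_nonneg : ∀ e, 0 ≤ weight e

namespace DirHypergraph

variable {V E : Type*}

/-- The energy `∑ e, w(e) * max {(x u - x v)₊ ^ 2 : u ∈ tail e, v ∈ head e}`. -/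
noncomputable def energy (H : DirHypergraph V E) (x : V → ℝ) : ℝ :=
  ∑ e ∈ H.edges, H.weight e *
    (H.tail e ×ˢ H.head e).sup' ((H.tail_nonempty e).product (H.head_nonempty e))
      (fun p => (max (x p.1 - x p.2) 0) ^ 2)

/-- `G` is a `(1 ± ε)`-spectral hypersparsifier of `H`. -/
def IsSpectralHypersparsifier {E' : Type*} (ε : ℝ) (G : DirHypergraph V E')
    (H : DirHypergraph V E) : Prop :=
  ∀ x : V → ℝ, (1 - ε) * H.energy x ≤ G.energy x ∧ G.energy x ≤ (1 + ε) * H.energy x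

/-- The largest number of vertices in a hyperedge. -/
def rank [DecidableEq V] (H : DirHypergraph V E) : ℕ :=
  H.edges.sup fun e => #(H.tail e ∪ H.head e)

/-- The hypergraph after the deletion of all hyperedges in the list `l`. -/
def deleteAll [DecidableEq E] (H : DirHypergraph V E) (l : List E) : DirHypergraph V E :=
  { H with edges := H.edges \ l.toFinset }

/-- The hypergraph `C ∪ S`: the hyperedges in `C` keep their weight, those in the sample `S`
get twice their weight. -/
noncomputable def coresetUnionSample [DecidableEq E] (H : DirHypergraph V E) (C S : Finset E) :
    DirHypergraph V E where
  edges := C ∪ S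
  tail := H.tail
  head := H.head
  weight := fun e => if e ∈ C then H.weight e else 2 * H.weight e
  tail_nonempty := H.tail_nonempty
  head_nonempty := H.head_nonempty
  weight_nonneg := fun e => by
    have h := H.weight_nonneg e
    split_ifs <;> linarith

/-- The set `E_{u,v}` of all hyperedges with `u` in the tail and `v` in the head. -/
def pairEdges [DecidableEq V] (H : DirHypergraph V E) (p : V × V) : Finset E :=
  H.edges.filter fun e => p.1 ∈ H.tail e ∧ p.2 ∈ H.head e

/-- `C` is a coreset with parameter `lam`: it is the disjoint union of sets `D (u, v) ⊆ E_{u,v}`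
with at most `lam` elements each, and as long as some hyperedge of `E_{u,v}` is outside `C`, the
set `D (u, v)` has exactly `lam` elements, all at least as heavy as that hyperedge. -/
def IsCoreset [DecidableEq V] (lam : ℕ) (H : DirHypergraph V E) (C : Finset E) : Prop :=
  ∃ D : V × V → Finset E,
    (∀ p q, p ≠ q → Disjoint (D p) (D q)) ∧
    (∀ e, e ∈ C ↔ ∃ p, e ∈ D p) ∧
    (∀ p, D p ⊆ H.pairEdges p ∧ #(D p) ≤ lam) ∧
    (∀ p, ∀ e ∈ H.pairEdges p, e ∉ C → #(D p) = lam ∧ ∀ f ∈ D p, H.weight e ≤ H.weight f)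

end DirHypergraph

/-! ### Step counting

A computation returns its value together with the number of elementary steps it made. The
elementary steps, each of cost one, are: inspecting a list (is it empty; if not, its first entry
and the pointer to the rest), one round of a loop, comparing two weights, reading or writing one
cell of a table (tables are random access and blank at the start), and tossing a coin. -/

/-- A value together with the number of elementary steps spent on computing it. -/
structure Timed (α : Type*) where
  val : α
  time : ℕ

namespace Timed

universe u v

instance : Monad Timed.{u} where
  pure a := ⟨a, 0⟩
  bind x f := ⟨(f x.val).val, x.time + (f x.val).time⟩

/-- One elementary step with the result `a`. -/
def step {α : Type u} (a : α) : Timed α := ⟨a, 1⟩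

/-- Read one cell of a table. -/
def read {α : Type v} {β : Type u} (T : α → β) (a : α) : Timed β := step (T a)

/-- Write one cell of a table. -/
def write {α : Type v} {β : Type u} [DecidableEq α] (T : α → β) (a : α) (b : β) :
    Timed (α → β) :=
  step (Function.update T a b)

/-- `for a in l do s := f a s`. -/
def forEach {α : Type v} {σ : Type u} (f : α → σ → Timed σ) : List α → σ → Timed σ
  | [], s => step s
  | a :: l, s => do
      let s ← step s
      let s ← f a s
      forEach f l s

/-- Distribute the entries of a list alternately to two lists. -/
def split {α : Type u} : List α → Timed (List α × List α)
  | [] => step ([], [])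
  | [a] => step ([a], [])
  | a :: b :: l => do
      let p ← split l
      step (a :: p.1, b :: p.2)

/-- Merge two sorted lists; `le` is one comparison. -/
def merge {α : Type u} (le : α → α → Bool) : List α → List α → Timed (List α)
  | [], l => step l
  | a :: l, [] => step (a :: l)
  | a :: l, b :: l' =>
      if le a b then do
        let k ← merge le l (b :: l')
        step (a :: k)
      else do
        let k ← merge le (a :: l) l'
        step (b :: k)
termination_by l l' => l.length + l'.length

/-- Merge sort. The first argument bounds the depth of the recursion; any number that is at least
the length of the list gives the sorted list. -/
def mergeSort {α : Type u} (le : α → α → Bool) : ℕ → List α → Timed (List α)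
  | 0, l => step l
  | _ + 1, [] => step []
  | _ + 1, [a] => step [a]
  | k + 1, a :: b :: l => do
      let p ← split (a :: b :: l)
      let l₁ ← mergeSort le k p.1
      let l₂ ← mergeSort le k p.2
      merge le l₁ l₂

end Timed

/-! ### The decremental data structure

A hypergraph is given to it as the list of its hyperedges, each with its weight and with the lists
of the vertices in its tail and in its head. -/

/-- The tables kept by the data structure.
* `inE (u, v, e)`: is `e` a current member of `E_{u,v}`?
* `queue (u, v)`: the members of `E_{u,v}` from highest to lowest weight, without the initial part
  that has been scanned; it may still hold hyperedges that have left `E_{u,v}` (see `inE`).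
* `pairs`: the pairs `(u, v)` for which `E_{u,v}` is nonempty at the start.
* `inC e`, `inS e`: is `e` in the coreset, in the sample?
* `source e`: the pair `(u, v)` from whose `E_{u,v}` the hyperedge `e` was added to the coreset. -/
structure CoresetDS (V E : Type*) where
  inE : V × V × E → Bool
  queue : V × V → List E
  pairs : List (V × V)
  inC : E → Bool
  inS : E → Bool
  source : E → Option (V × V)

namespace CoresetDS

variable {V E : Type*}

/-- The current coreset `C`. -/
def coreset [Fintype E] (s : CoresetDS V E) : Finset E := univ.filter fun e => s.inC e = true

/-- The current sample `S`. -/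
def sample [Fintype E] (s : CoresetDS V E) : Finset E := univ.filter fun e => s.inS e = true

/-- The blank tables. -/
def blank : CoresetDS V E where
  inE := fun _ => false
  queue := fun _ => []
  pairs := []
  inC := fun _ => false
  inS := fun _ => false
  source := fun _ => none

end CoresetDS

namespace DecrementalCoresetAndSample

open Timed

variable {V E : Type} [LinearOrder V] [LinearOrder E]

/-- Run `f u v` for all pairs `(u, v)` with `u ∈ tail e`, `v ∈ head e`. -/
def forEachPair (H : DirHypergraph V E) (e : E)
    (f : V → V → CoresetDS V E → Timed (CoresetDS V E)) (s : CoresetDS V E) :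
    Timed (CoresetDS V E) :=
  forEach (fun u s => forEach (fun v s => f u v s) ((H.head e).sort (· ≤ ·)) s)
    ((H.tail e).sort (· ≤ ·)) s

/-- Put `e` in front of the queue of `E_{u,v}`. -/
def push (e : E) (u v : V) (s : CoresetDS V E) : Timed (CoresetDS V E) := do
  let q ← read s.queue (u, v)
  let queue ← write s.queue (u, v) (e :: q)
  let inE ← write s.inE (u, v, e) true
  match q with
  | [] => step { s with queue := queue, inE := inE, pairs := (u, v) :: s.pairs }
  | _ :: _ => step { s with queue := queue, inE := inE }

/-- Build all `E_{u,v}`, each ordered from highest to lowest weight: go through the hyperedges from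
lowest to highest weight and put each in front of the queues to which it belongs. -/
noncomputable def build (H : DirHypergraph V E) : Timed (CoresetDS V E) := do
  let l ← mergeSort (fun e f => decide (H.weight e ≤ H.weight f)) #H.edges (H.edges.sort (· ≤ ·))
  forEach (fun e s => forEachPair H e (push e) s) l CoresetDS.blank

/-- Scan a queue of `E_{u,v}` up to the first member of `E_{u,v} \ C`; return it (if there is one)
and the rest of the queue. -/
def scan (s : CoresetDS V E) (u v : V) : List E → Timed (Option E × List E)
  | [] => step (none, [])
  | e :: q => do
      let a ← read s.inE (u, v, e)
      let b ← read s.inC e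
      if a && !b then step (some e, q)
      else do
        let r ← scan s u v q
        step r

/-- Move a heaviest hyperedge of `E_{u,v} \ C` to `C` (and out of `S`), if there is one; the
Boolean says whether there was one. -/
def addHeaviest (u v : V) (s : CoresetDS V E) : Timed (CoresetDS V E × Bool) := do
  let q ← read s.queue (u, v)
  let r ← scan s u v q
  let queue ← write s.queue (u, v) r.2
  match r.1 with
  | none => step ({ s with queue := queue }, false)
  | some e => do
      let inC ← write s.inC e true
      let source ← write s.source e (some (u, v))
      let inS ← write s.inS e false
      step ({ s with queue := queue, inC := inC, source := source, inS := inS }, true)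

/-- Move the `k` heaviest hyperedges of `E_{u,v} \ C` to `C` (all of them if there are fewer). -/
def addHeaviestMany : ℕ → V → V → CoresetDS V E → Timed (CoresetDS V E)
  | 0, _, _, s => step s
  | k + 1, u, v, s => do
      let r ← addHeaviest u v s
      if r.2 then addHeaviestMany k u v r.1 else step r.1

/-- Toss the coin of `e` if `e` is outside `C`, and put `e` into `S` if it shows `true`. -/
def toss (ω : E → Bool) (e : E) (s : CoresetDS V E) : Timed (CoresetDS V E) := do
  let b ← read s.inC e
  if b then step s
  else do
    let a ← step (ω e)
    let inS ← write s.inS e a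
    step { s with inS := inS }

/-- Initialization: build the ordered sets `E_{u,v}`, greedily form the coreset, and sample the
hyperedges outside it. -/
noncomputable def initialState (lam : ℕ) (H : DirHypergraph V E) (ω : E → Bool) :
    Timed (CoresetDS V E) := do
  let s ← build H
  let s ← forEach (fun p s => addHeaviestMany lam p.1 p.2 s) s.pairs s
  forEach (toss ω) (H.edges.sort (· ≤ ·)) s

/-- If `e` is in `C`, replace it by a heaviest hyperedge of `E_{u,v} \ C`, where `E_{u,v}` is the
set from which `e` was added to `C`. -/
def replace (e : E) (s : CoresetDS V E) : Timed (CoresetDS V E) := do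
  let b ← read s.inC e
  if b then do
    let p ← read s.source e
    match p with
    | none => step s
    | some p => do
        let r ← addHeaviest p.1 p.2 s
        let inC ← write r.1.inC e false
        step { r.1 with inC := inC }
  else step s

/-- The deletion of the hyperedge `e`. -/
def delete (H : DirHypergraph V E) (e : E) (s : CoresetDS V E) : Timed (CoresetDS V E) := do
  let s ← replace e s
  let s ← forEachPair H e (fun u v s => do
    let inE ← write s.inE (u, v, e) false
    step { s with inE := inE }) s
  let inS ← write s.inS e false
  step { s with inS := inS }

/-- Initialize for `H` and then delete the hyperedges in the list `l` one after the other; `ω` are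
the coin tosses. The time is that of the initialization and of all deletions together. -/
noncomputable def run (lam : ℕ) (H : DirHypergraph V E) (ω : E → Bool) (l : List E) :
    Timed (CoresetDS V E) := do
  let s ← initialState lam H ω
  forEach (delete H) l s

/-- Independent fair coins, one for each hyperedge. -/
noncomputable def fairCoins (E : Type) [Fintype E] : Measure (E → Bool) :=
  Measure.pi fun _ => (PMF.uniformOfFintype Bool).toMeasure

end DecrementalCoresetAndSample

/-! Sparsification at a fixed time. A hyperedge outside the coreset `C` counts twice or not at all,
so the energy error at `x` is `∑ σ_e Q_e(x)` over `e ∉ C`, with independent signs `σ_e`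
(`energy_coresetUnionSample_sub`). It must be at most `ε Q_H(x)` for all `x` at once. Let `W_p` be
the largest weight left in `E_p \ C`. The set `D_p` holds `λ` hyperedges at least that heavy, and
the `D_p` are disjoint, so `λ ∑ W_p (x_u - x_v)₊² ≤ Q_H(x)` (`IsCoreset.sum_outerWeight_le_energy`).
With `y_p = √(W_p / Q_H(x)) (x_u - x_v)₊`, the vector `y` therefore has Euclidean norm at most `B =
1/√λ`, and `Q_e(x) / Q_H(x) = q_e(y)²` for a weighted maximum norm `q_e` with coefficients at most
one.

It remains to bound `∑ σ_e q_e(y)²` uniformly over this ball, intersected with `∑ q_e(y)² ≤ 1`. This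
is done by chaining. Round `y` down to multiples of `B / 2^k`. In these units the rounded vector has
entries of sum at most `4^k`, so there are at most `(m + 1)^(4^k)` such vectors. A link between
consecutive scales is a signed sum of variance at most `4 (B / 2^k)²`, and the probability that it
exceeds `s ≈ B √(log m)` is `m^(-Ω(4^k))`, which beats the count. About `log m` scales give an error
of order `B log^(3/2) m`, which is at most `ε` for the chosen `λ`
(`measure_exists_abs_signedSum_gt_le`).

All times. For a fixed deletion sequence no decision about the coreset looks at a coin or at the
sample, so `C_t` is deterministic (`coreset_run_eq`) and the fixed-time bound applies for each `t`;
a union bound over at most `m + 1` times follows. The size needs only one event: every sample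
consists of successes among the original `m` hyperedges, and Hoeffding's inequality bounds their
number.

Invariants and time. A deleted member of the coreset is replaced from the same `E_{u,v}`, which
keeps `D_{u,v}` full (`Valid.delete`). Availability is never regained, so scanned queue entries can
be discarded; the total queue length is a potential that pays for all scanning. Filling the queues
costs `O(r²)` per hyperedge, sorting `O(m log m)`. -/

/-! ### Signed sums of fair coins -/

section Coins

open DecrementalCoresetAndSample ProbabilityTheory

/-- The sign of a coin toss. -/
noncomputable def coinSign (b : Bool) : ℝ := if b then 1 else -1

instance isProbabilityMeasure_fairCoins (E : Type) [Fintype E] :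
    IsProbabilityMeasure (fairCoins E) := by
  unfold fairCoins; infer_instance

theorem measurableSet_coins {E : Type} [Fintype E] (s : Set (E → Bool)) : MeasurableSet s :=
  s.toFinite.measurableSet

theorem integral_exp_mul_coinSign (a : ℝ) :
    ∫ b, Real.exp (a * coinSign b) ∂(PMF.uniformOfFintype Bool).toMeasure = Real.cosh a := by
  rw [PMF.integral_eq_sum]
  simp [coinSign, Real.cosh_eq]
  ring

theorem integral_exp_signedSum {E : Type} [Fintype E] (a : E → ℝ) :
    ∫ ω, Real.exp (∑ e, a e * coinSign (ω e)) ∂(fairCoins E) = ∏ e, Real.cosh (a e) := by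
  simp_rw [Real.exp_sum]
  unfold fairCoins
  rw [integral_fintype_prod_eq_prod (fun e b => Real.exp (a e * coinSign b))]
  simp_rw [integral_exp_mul_coinSign]

/-- Chernoff bound: the moment generating function is a product of `cosh (t a_e) ≤ exp (t² a_e² /
2)`. -/
theorem measure_signedSum_ge_le {E : Type} [Fintype E] (a : E → ℝ) {V s : ℝ} (hV : 0 < V)
    (hs : 0 ≤ s) (ha : ∑ e, a e ^ 2 ≤ V) :
    (fairCoins E).real {ω | s ≤ ∑ e, a e * coinSign (ω e)} ≤ Real.exp (-(s ^ 2 / (2 * V))) := by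
  -- `t = s / V` minimizes the exponent `t² V / 2 - t s`.
  have ht : 0 ≤ s / V := by positivity
  refine (measure_ge_le_exp_mul_mgf s ht Integrable.of_finite).trans ?_
  have h1 : mgf (fun ω : E → Bool => ∑ e, a e * coinSign (ω e)) (fairCoins E) (s / V)
      ≤ Real.exp (s ^ 2 / (2 * V)) := by
    unfold mgf
    simp_rw [Finset.mul_sum, ← mul_assoc]
    rw [integral_exp_signedSum (fun e => s / V * a e)]
    calc ∏ e, Real.cosh (s / V * a e) ≤ ∏ e, Real.exp ((s / V * a e) ^ 2 / 2) :=
          Finset.prod_le_prod (fun e _ => (Real.cosh_pos _).le)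
            (fun e _ => Real.cosh_le_exp_half_sq _)
      _ = Real.exp ((s / V) ^ 2 / 2 * ∑ e, a e ^ 2) := by
          rw [← Real.exp_sum, Finset.mul_sum]
          congr 1
          refine Finset.sum_congr rfl fun e _ => by ring
      _ ≤ Real.exp (s ^ 2 / (2 * V)) := by
          apply Real.exp_le_exp.mpr
          calc (s / V) ^ 2 / 2 * ∑ e, a e ^ 2 ≤ (s / V) ^ 2 / 2 * V := by gcongr
            _ = s ^ 2 / (2 * V) := by field_simp
  calc Real.exp (-(s / V) * s) * _ ≤ Real.exp (-(s / V) * s) * Real.exp (s ^ 2 / (2 * V)) := by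
        gcongr
    _ = Real.exp (-(s ^ 2 / (2 * V))) := by
        rw [← Real.exp_add]
        congr 1
        field_simp
        ring

theorem measure_abs_signedSum_gt_le {E : Type} [Fintype E] (R : Finset E) (a : E → ℝ) {V s : ℝ}
    (hV : 0 < V) (hs : 0 ≤ s) (ha : ∑ e ∈ R, a e ^ 2 ≤ V) :
    (fairCoins E).real {ω | s < |∑ e ∈ R, coinSign (ω e) * a e|}
      ≤ 2 * Real.exp (-(s ^ 2 / (2 * V))) := by
  classical
  set b : E → ℝ := fun e => if e ∈ R then a e else 0 with hb
  have hsum : ∀ ω : E → Bool, ∑ e ∈ R, coinSign (ω e) * a e = ∑ e, b e * coinSign (ω e) := by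
    intro ω
    simp [hb, Finset.sum_ite_mem, mul_comm]
  have hb2 : ∑ e, b e ^ 2 ≤ V := by
    simpa [hb, ite_pow, Finset.sum_ite_mem] using ha
  have h1 := measure_signedSum_ge_le b hV hs hb2
  have h2 := measure_signedSum_ge_le (fun e => -b e) hV hs (by simpa using hb2)
  have hsub : {ω : E → Bool | s < |∑ e ∈ R, coinSign (ω e) * a e|} ⊆
      {ω | s ≤ ∑ e, b e * coinSign (ω e)} ∪ {ω | s ≤ ∑ e, -b e * coinSign (ω e)} := by
    intro ω hω
    simp only [Set.mem_ofPred_eq, hsum] at hω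
    simp only [Set.mem_union, Set.mem_ofPred_eq, neg_mul, Finset.sum_neg_distrib]
    rcases lt_abs.mp hω with h | h
    · exact Or.inl h.le
    · exact Or.inr h.le
  calc _ ≤ _ := measureReal_mono hsub
    _ ≤ _ := measureReal_union_le _ _
    _ ≤ _ := by linarith

/-- Hoeffding's inequality for the number of successes. -/
theorem measure_card_success_gt_le {E : Type} [Fintype E] (R : Finset E) (hR : R.Nonempty) {s : ℝ}
    (hs : 0 ≤ s) :
    (fairCoins E).real {ω | (#R : ℝ) / 2 + s < #(R.filter fun e => ω e = true)}
      ≤ 2 * Real.exp (-(2 * s ^ 2 / #R)) := by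
  have hpos : (0 : ℝ) < #R := by exact_mod_cast hR.card_pos
  have h := measure_abs_signedSum_gt_le R (fun _ => (1 : ℝ)) (V := #R) (s := 2 * s) hpos
    (by positivity) (by simp)
  refine (measureReal_mono ?_).trans (h.trans (le_of_eq ?_))
  · intro ω hω
    simp only [Set.mem_ofPred_eq] at hω ⊢
    refine lt_of_lt_of_le ?_ (le_abs_self _)
    have : ∑ e ∈ R, coinSign (ω e) * 1 = 2 * #(R.filter fun e => ω e = true) - #R := by
      rw [Finset.card_filter, Finset.card_eq_sum_ones]
      push_cast
      rw [Finset.mul_sum, ← Finset.sum_sub_distrib]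
      refine Finset.sum_congr rfl fun e _ => ?_
      cases ω e <;> norm_num [coinSign]
    rw [this]
    linarith
  · congr 2
    field_simp

end Coins

/-! ### Nonnegative integer vectors with bounded sum -/

section NatVecs

variable {ι : Type*}

open Classical in
/-- A finite set containing the vectors of natural numbers that are supported on `P` and have sum
at most `N`. -/
noncomputable def natVecs (P : Finset ι) : ℕ → Finset (ι → ℕ)
  | 0 => {0}
  | N + 1 => natVecs P N ∪ ((natVecs P N) ×ˢ P).image fun zp => zp.1 + Pi.single zp.2 1

/-- Each of the `N` rounds either adds nothing or adds a unit vector at one of the `#P` coordinates.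
-/
theorem card_natVecs_le (P : Finset ι) (N : ℕ) : #(natVecs P N) ≤ (#P + 1) ^ N := by
  classical
  induction N with
  | zero => simp [natVecs]
  | succ N ih =>
    rw [natVecs]
    calc _ ≤ #(natVecs P N) + #(natVecs P N) * #P := by
          refine (card_union_le _ _).trans ?_
          gcongr
          exact card_image_le.trans (card_product _ _).le
      _ = #(natVecs P N) * (#P + 1) := by ring
      _ ≤ _ := by rw [pow_succ]; gcongr

theorem mem_natVecs (P : Finset ι) (N : ℕ) (z : ι → ℕ) (hz : ∀ p ∉ P, z p = 0)
    (hsum : ∑ p ∈ P, z p ≤ N) : z ∈ natVecs P N := by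
  classical
  induction N generalizing z with
  | zero =>
    rw [natVecs, mem_singleton]
    funext p
    by_cases hp : p ∈ P
    · exact (Finset.sum_eq_zero_iff.mp (Nat.le_zero.mp hsum)) p hp
    · exact hz p hp
  | succ N ih =>
    rw [natVecs, mem_union]
    by_cases h0 : ∀ p ∈ P, z p = 0
    · exact Or.inl (ih z hz (by rw [Finset.sum_eq_zero h0]; omega))
    · push Not at h0
      obtain ⟨p, hp, hzp⟩ := h0
      refine Or.inr (mem_image.mpr ⟨(z - Pi.single p 1, p), ?_, ?_⟩)
      · refine mem_product.mpr ⟨ih _ (fun p' hp' => by simp [hz p' hp']) ?_, hp⟩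
        have hs1 : ∑ p' ∈ P, (z - Pi.single p 1 : ι → ℕ) p' + 1 = ∑ p' ∈ P, z p' := by
          rw [← Finset.add_sum_erase P _ hp, ← Finset.add_sum_erase P z hp]
          have : ∑ x ∈ P.erase p, (z - Pi.single p 1 : ι → ℕ) x = ∑ x ∈ P.erase p, z x := by
            refine Finset.sum_congr rfl fun x hx => ?_
            simp [Pi.single_eq_of_ne (ne_of_mem_erase hx)]
          rw [this]
          simp only [Pi.sub_apply, Pi.single_eq_same]
          omega
        show ∑ p' ∈ P, (z - Pi.single p 1 : ι → ℕ) p' ≤ N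
        omega
      · funext x
        by_cases hx : x = p
        · subst hx; simp; omega
        · simp [Pi.single_eq_of_ne hx]

end NatVecs

/-! ### Chaining -/

section Chaining

open DecrementalCoresetAndSample

variable {ι : Type*} {E : Type}

/-- Functions like a weighted maximum norm on the nonnegative vectors: monotone, `1`-Lipschitz for
the supremum norm, and zero at the origin. -/
structure IsMaxNormLike (q : (ι → ℝ) → ℝ) : Prop where
  zero : q 0 = 0
  mono : ∀ y y', 0 ≤ y → y ≤ y' → q y ≤ q y'
  lipschitz : ∀ y y', 0 ≤ y → y ≤ y' → ∀ δ : ℝ, 0 ≤ δ → (∀ p, y' p ≤ y p + δ) → q y' ≤ q y + δ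

theorem IsMaxNormLike.nonneg {q : (ι → ℝ) → ℝ} (hq : IsMaxNormLike q) {y : ι → ℝ} (hy : 0 ≤ y) :
    0 ≤ q y := hq.zero ▸ hq.mono 0 y le_rfl hy

/-- The vector with the entries `δ * z p`. -/
def scaledVec (δ : ℝ) (z : ι → ℕ) : ι → ℝ := fun p => δ * z p

/-- The largest even numbers below the entries. -/
def evenPart (z : ι → ℕ) : ι → ℕ := fun p => 2 * (z p / 2)

/-- The multiples of `δ`, in units of `δ`, just below the entries of `y`. -/
noncomputable def floorVec (δ : ℝ) (y : ι → ℝ) : ι → ℕ := fun p => ⌊y p / δ⌋₊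

theorem scaledVec_nonneg {δ : ℝ} (hδ : 0 ≤ δ) (z : ι → ℕ) : 0 ≤ scaledVec δ z :=
  fun p => by simp only [scaledVec, Pi.zero_apply]; positivity

theorem scaledVec_evenPart_le {δ : ℝ} (hδ : 0 ≤ δ) (z : ι → ℕ) :
    scaledVec δ (evenPart z) ≤ scaledVec δ z := fun p => by
  simp only [scaledVec, evenPart]
  gcongr
  omega

theorem scaledVec_floorVec_le {δ : ℝ} (hδ : 0 < δ) {y : ι → ℝ} (hy : 0 ≤ y) :
    scaledVec δ (floorVec δ y) ≤ y := fun p => by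
  have h := Nat.floor_le (div_nonneg (hy p) hδ.le)
  rw [le_div_iff₀ hδ] at h
  simpa [scaledVec, floorVec, mul_comm] using h

theorem le_scaledVec_floorVec_add {δ : ℝ} (hδ : 0 < δ) (y : ι → ℝ) (p : ι) :
    y p ≤ scaledVec δ (floorVec δ y) p + δ := by
  have h := (Nat.lt_floor_add_one (y p / δ)).le
  rw [div_le_iff₀ hδ] at h
  simp only [scaledVec, floorVec]
  linarith

/-- This lets the union bound run over one vector per link: the coarser end of a link is a function
of the finer one, so pairs of net points need not be counted. -/
theorem scaledVec_evenPart_floorVec (δ : ℝ) (y : ι → ℝ) :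
    scaledVec δ (evenPart (floorVec δ y)) = scaledVec (2 * δ) (floorVec (2 * δ) y) := by
  funext p
  have h : ⌊y p / δ⌋₊ / 2 = ⌊y p / (2 * δ)⌋₊ := by
    rw [mul_comm, ← div_div]
    exact (Nat.floor_div_natCast (y p / δ) 2).symm
  simp only [scaledVec, evenPart, floorVec, h]
  push_cast
  ring

/-- Factor the difference of squares. Keeping `q y'` on the right, instead of a constant, is what
makes the variance of a link independent of the number of hyperedges. -/
theorem IsMaxNormLike.abs_sq_sub_sq_le {q : (ι → ℝ) → ℝ} (hq : IsMaxNormLike q) {y y' : ι → ℝ}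
    (hy : 0 ≤ y) (hyy' : y ≤ y') {δ : ℝ} (hδ : 0 ≤ δ) (h : ∀ p, y' p ≤ y p + δ) :
    |q y' ^ 2 - q y ^ 2| ≤ 2 * δ * q y' := by
  have h0 := hq.nonneg hy
  have h1 := hq.mono y y' hy hyy'
  have h2 := hq.lipschitz y y' hy hyy' δ hδ h
  rw [abs_of_nonneg (by nlinarith)]
  nlinarith

/-- One link of the chain. -/
theorem measure_increment_gt_le [Fintype E] (R : Finset E) (q : E → (ι → ℝ) → ℝ)
    (hq : ∀ e, IsMaxNormLike (q e)) {δ s : ℝ} (hδ : 0 < δ) (hs : 0 ≤ s) (P : Finset ι) (N : ℕ) :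
    (fairCoins E).real {ω | ∃ z ∈ natVecs P N, ∑ e ∈ R, q e (scaledVec δ z) ^ 2 ≤ 1 ∧
        s < |∑ e ∈ R, coinSign (ω e) *
          (q e (scaledVec δ z) ^ 2 - q e (scaledVec δ (evenPart z)) ^ 2)|}
      ≤ (#P + 1 : ℝ) ^ N * (2 * Real.exp (-(s ^ 2 / (8 * δ ^ 2)))) := by
  classical
  set Z := (natVecs P N).filter fun z => ∑ e ∈ R, q e (scaledVec δ z) ^ 2 ≤ 1 with hZ
  have hcard : (#Z : ℝ) ≤ (#P + 1 : ℝ) ^ N := by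
    exact_mod_cast (card_filter_le _ _).trans (card_natVecs_le P N)
  set A : (ι → ℕ) → Set (E → Bool) := fun z => {ω | s < |∑ e ∈ R, coinSign (ω e) *
    (q e (scaledVec δ z) ^ 2 - q e (scaledVec δ (evenPart z)) ^ 2)|} with hA
  refine (measureReal_mono (s₂ := ⋃ z ∈ Z, A z) ?_ (measure_ne_top _ _)).trans
    ((measureReal_biUnion_finset_le Z A).trans ?_)
  · rintro ω ⟨z, hz, h1, h2⟩
    simp only [Set.mem_iUnion]
    exact ⟨z, mem_filter.mpr ⟨hz, h1⟩, h2⟩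
  calc ∑ z ∈ Z, (fairCoins E).real (A z)
      ≤ ∑ z ∈ Z, 2 * Real.exp (-(s ^ 2 / (8 * δ ^ 2))) := by
        refine Finset.sum_le_sum fun z hz => ?_
        have h1 := (mem_filter.mp hz).2
        -- The variance bound is `4 δ²`: each coefficient is at most `2 δ q_e`, and the squares
        -- `q_e²` sum to at most one.
        have h8 : 8 * δ ^ 2 = 2 * (4 * δ ^ 2) := by ring
        rw [h8]
        refine measure_abs_signedSum_gt_le R _ (by positivity) hs ?_
        calc ∑ e ∈ R, (q e (scaledVec δ z) ^ 2 - q e (scaledVec δ (evenPart z)) ^ 2) ^ 2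
            ≤ ∑ e ∈ R, 4 * δ ^ 2 * q e (scaledVec δ z) ^ 2 := by
              refine Finset.sum_le_sum fun e _ => ?_
              have := (hq e).abs_sq_sub_sq_le (scaledVec_nonneg hδ.le (evenPart z))
                (scaledVec_evenPart_le hδ.le z) hδ.le (fun p => by
                  simp only [scaledVec, evenPart]
                  have : (z p : ℝ) ≤ ((2 * (z p / 2) + 1 : ℕ) : ℝ) := by
                    exact_mod_cast (by omega)
                  push_cast at this ⊢
                  nlinarith)
              calc _ ≤ (2 * δ * q e (scaledVec δ z)) ^ 2 := sq_le_sq' (neg_le_of_abs_le this)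
                    (le_of_abs_le this)
                _ = _ := by ring
          _ = 4 * δ ^ 2 * ∑ e ∈ R, q e (scaledVec δ z) ^ 2 := by rw [Finset.mul_sum]
          _ ≤ 4 * δ ^ 2 := by nlinarith [sq_nonneg δ]
    _ = #Z * (2 * Real.exp (-(s ^ 2 / (8 * δ ^ 2)))) := by rw [sum_const, nsmul_eq_mul]
    _ ≤ _ := by gcongr

/-- A natural number is at most its square, so the `ℓ²` bound on `y` controls the sum of the rounded
entries. This replaces a covering number estimate. -/
theorem floorVec_mem_natVecs {P : Finset ι} {y : ι → ℝ} {B : ℝ} (hB : 0 < B) (hy : 0 ≤ y)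
    (hP : ∀ p ∉ P, y p = 0) (hyB : ∑ p ∈ P, y p ^ 2 ≤ B ^ 2) (k : ℕ) :
    floorVec (B / 2 ^ k) y ∈ natVecs P (4 ^ k) := by
  refine mem_natVecs _ _ _ (fun p hp => by simp [floorVec, hP p hp]) ?_
  have h : ((∑ p ∈ P, floorVec (B / 2 ^ k) y p : ℕ) : ℝ) ≤ ((4 ^ k : ℕ) : ℝ) := by
    push_cast
    calc ∑ p ∈ P, (floorVec (B / 2 ^ k) y p : ℝ) ≤ ∑ p ∈ P, (y p / (B / 2 ^ k)) ^ 2 := by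
          refine Finset.sum_le_sum fun p _ => ?_
          have hpos : 0 ≤ y p / (B / 2 ^ k) := div_nonneg (hy p) (by positivity)
          calc (floorVec (B / 2 ^ k) y p : ℝ) ≤ (floorVec (B / 2 ^ k) y p : ℝ) ^ 2 := by
                exact_mod_cast Nat.le_self_pow (by norm_num) _
            _ ≤ _ := pow_le_pow_left₀ (Nat.cast_nonneg _) (Nat.floor_le hpos) 2
      _ = (4 ^ k / B ^ 2) * ∑ p ∈ P, y p ^ 2 := by
          rw [Finset.mul_sum]
          refine Finset.sum_congr rfl fun p _ => ?_
          have : (4 : ℝ) ^ k = (2 ^ k) ^ 2 := by rw [← pow_mul, mul_comm, pow_mul]; norm_num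
          rw [this]
          field_simp
      _ ≤ (4 ^ k / B ^ 2) * B ^ 2 := by gcongr
      _ = 4 ^ k := by field_simp
  exact_mod_cast h

/-- The chain starts at the origin: no entry exceeds `B`, so in units of `B` every rounded entry is
0 or 1. -/
theorem evenPart_floorVec_eq_zero {P : Finset ι} {y : ι → ℝ} {B : ℝ} (hB : 0 < B) (hy : 0 ≤ y)
    (hP : ∀ p ∉ P, y p = 0) (hyB : ∑ p ∈ P, y p ^ 2 ≤ B ^ 2) (p : ι) :
    evenPart (floorVec B y) p = 0 := by
  have h : y p ≤ B := by
    by_cases hp : p ∈ P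
    · have h1 : y p ^ 2 ≤ B ^ 2 :=
        (Finset.single_le_sum (f := fun p => y p ^ 2) (fun p _ => sq_nonneg _) hp).trans hyB
      exact le_of_sq_le_sq h1 hB.le
    · rw [hP p hp]; exact hB.le
  have h2 : ⌊y p / B⌋₊ < 2 := by
    rw [Nat.floor_lt (div_nonneg (hy p) hB.le)]
    have : y p / B ≤ 1 := (div_le_one hB).mpr h
    push_cast
    linarith
  simp only [evenPart, floorVec]
  omega

/-- The chain: if no link is long, then the signed sum is small. -/
theorem abs_signedSum_le_of_increments_le (R : Finset E) (q : E → (ι → ℝ) → ℝ)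
    (hq : ∀ e, IsMaxNormLike (q e)) {B s : ℝ} (hB : 0 < B) (P : Finset ι) (σ : E → ℝ)
    (hσ : ∀ e, |σ e| ≤ 1) {m : ℕ} (hR : #R ≤ m) (L : ℕ) (hL : m ≤ 2 ^ L)
    (hinc : ∀ k ≤ L, ∀ z ∈ natVecs P (4 ^ k), ∑ e ∈ R, q e (scaledVec (B / 2 ^ k) z) ^ 2 ≤ 1 →
      |∑ e ∈ R, σ e * (q e (scaledVec (B / 2 ^ k) z) ^ 2
          - q e (scaledVec (B / 2 ^ k) (evenPart z)) ^ 2)| ≤ s)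
    (y : ι → ℝ) (hy : 0 ≤ y) (hP : ∀ p ∉ P, y p = 0) (hyB : ∑ p ∈ P, y p ^ 2 ≤ B ^ 2)
    (hqy : ∑ e ∈ R, q e y ^ 2 ≤ 1) :
    |∑ e ∈ R, σ e * q e y ^ 2| ≤ (L + 1) * s + 2 * B := by
  set Y : ℕ → ι → ℝ := fun k => scaledVec (B / 2 ^ k) (floorVec (B / 2 ^ k) y) with hY
  have hpos : ∀ k : ℕ, 0 < B / 2 ^ k := fun k => by positivity
  have hYle : ∀ k, Y k ≤ y := fun k => scaledVec_floorVec_le (hpos k) hy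
  have hY0 : ∀ k, 0 ≤ Y k := fun k => scaledVec_nonneg (hpos k).le _
  have hYsum : ∀ k, ∑ e ∈ R, q e (Y k) ^ 2 ≤ 1 := fun k =>
    (Finset.sum_le_sum fun e _ => pow_le_pow_left₀ ((hq e).nonneg (hY0 k))
      ((hq e).mono _ _ (hY0 k) (hYle k)) 2).trans hqy
  have hlink : ∀ k ≤ L, |∑ e ∈ R, σ e * (q e (Y k) ^ 2
      - q e (scaledVec (B / 2 ^ k) (evenPart (floorVec (B / 2 ^ k) y))) ^ 2)| ≤ s := fun k hk =>
    hinc k hk _ (floorVec_mem_natVecs hB hy hP hyB k) (hYsum k)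
  have hchain : ∀ k ≤ L, |∑ e ∈ R, σ e * q e (Y k) ^ 2| ≤ (k + 1) * s := by
    intro k
    induction k with
    | zero =>
      intro hk
      have h := hlink 0 hk
      have hz : scaledVec (B / 2 ^ 0) (evenPart (floorVec (B / 2 ^ 0) y)) = 0 := by
        funext p
        simp [scaledVec, evenPart_floorVec_eq_zero hB hy hP hyB p]
      rw [hz] at h
      simpa [(hq _).zero] using h
    | succ k ih =>
      intro hk
      have h1 := ih (by omega)
      have h2 := hlink (k + 1) hk
      rw [scaledVec_evenPart_floorVec, show 2 * (B / 2 ^ (k + 1)) = B / 2 ^ k by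
        rw [pow_succ]; field_simp] at h2
      have h3 : ∑ e ∈ R, σ e * q e (Y (k + 1)) ^ 2 = ∑ e ∈ R, σ e * q e (Y k) ^ 2
          + ∑ e ∈ R, σ e * (q e (Y (k + 1)) ^ 2 - q e (Y k) ^ 2) := by
        rw [← Finset.sum_add_distrib]
        exact Finset.sum_congr rfl fun e _ => by ring
      rw [h3]
      calc _ ≤ _ := abs_add_le _ _
        _ ≤ (k + 1) * s + s := add_le_add h1 h2
        _ = _ := by push_cast; ring
  -- Below the finest scale no randomness is needed: at most `2^L` terms each change by at most `2 B
  -- / 2^L`.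
  have hrest : |∑ e ∈ R, σ e * (q e y ^ 2 - q e (Y L) ^ 2)| ≤ 2 * B := by
    calc _ ≤ ∑ e ∈ R, |σ e * (q e y ^ 2 - q e (Y L) ^ 2)| := Finset.abs_sum_le_sum_abs _ _
      _ ≤ ∑ e ∈ R, 2 * (B / 2 ^ L) := by
          refine Finset.sum_le_sum fun e he => ?_
          have h1 : q e y ≤ 1 := by
            have := (Finset.single_le_sum (f := fun e => q e y ^ 2)
              (fun e _ => sq_nonneg _) he).trans hqy
            nlinarith [(hq e).nonneg hy]
          rw [abs_mul]
          calc _ ≤ 1 * (2 * (B / 2 ^ L) * q e y) := by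
                gcongr
                · exact hσ e
                · exact (hq e).abs_sq_sub_sq_le (hY0 L) (hYle L) (hpos L).le
                    (le_scaledVec_floorVec_add (hpos L) y)
            _ ≤ 1 * (2 * (B / 2 ^ L) * 1) := by have := hpos L; gcongr
            _ = _ := by ring
      _ = #R * (2 * (B / 2 ^ L)) := by rw [sum_const, nsmul_eq_mul]
      _ ≤ 2 ^ L * (2 * (B / 2 ^ L)) := by
          have := hpos L
          gcongr
          exact_mod_cast hR.trans hL
      _ = 2 * B := by field_simp
  have h3 : ∑ e ∈ R, σ e * q e y ^ 2 = ∑ e ∈ R, σ e * q e (Y L) ^ 2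
      + ∑ e ∈ R, σ e * (q e y ^ 2 - q e (Y L) ^ 2) := by
    rw [← Finset.sum_add_distrib]
    exact Finset.sum_congr rfl fun e _ => by ring
  rw [h3]
  exact (abs_add_le _ _).trans (add_le_add (hchain L le_rfl) hrest)

theorem abs_coinSign_le (b : Bool) : |coinSign b| ≤ 1 := by cases b <;> simp [coinSign]

theorem log_two_gt_half : (1 : ℝ) / 2 < Real.log 2 := by
  have := Real.log_two_gt_d9
  linarith

theorem half_lt_log {m : ℕ} (hm : 2 ≤ m) : (1 : ℝ) / 2 < Real.log m :=
  log_two_gt_half.trans_le (Real.log_le_log (by norm_num) (by exact_mod_cast hm))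

theorem natLog_le_two_mul_log {m : ℕ} (hm : 2 ≤ m) : (Nat.log 2 m : ℝ) ≤ 2 * Real.log m := by
  have h : (2 : ℝ) ^ Nat.log 2 m ≤ m := by exact_mod_cast Nat.pow_log_le_self 2 (by omega)
  have h2 := Real.log_le_log (by positivity) h
  rw [Real.log_pow] at h2
  nlinarith [log_two_gt_half, (Nat.cast_nonneg (Nat.log 2 m) : (0 : ℝ) ≤ _)]

/-- With high probability, the signed sums of the squares of functions like a maximum norm are
uniformly small. -/
theorem measure_exists_abs_signedSum_gt_le [Fintype E] (R : Finset E) (q : E → (ι → ℝ) → ℝ)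
    (hq : ∀ e, IsMaxNormLike (q e)) {B c : ℝ} (hB : 0 < B) (hc : 0 ≤ c) (P : Finset ι) {m : ℕ}
    (hm : 2 ≤ m) (hR : #R ≤ m) (hP : #P ≤ m) :
    (fairCoins E).real {ω | ∃ y : ι → ℝ, 0 ≤ y ∧ (∀ p ∉ P, y p = 0) ∧ ∑ p ∈ P, y p ^ 2 ≤ B ^ 2 ∧
        ∑ e ∈ R, q e y ^ 2 ≤ 1 ∧
        12 * Real.log m * (B * √(8 * (c + 8) * Real.log m))
          < |∑ e ∈ R, coinSign (ω e) * q e y ^ 2|}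
      ≤ Real.exp (-((c + 3) * Real.log m)) := by
  have hl := half_lt_log hm
  set l := Real.log m with hldef
  have hmpos : (0 : ℝ) < m := by positivity
  have hml : (m : ℝ) = Real.exp l := (Real.exp_log hmpos).symm
  have hm2 : (2 : ℝ) ≤ m := by exact_mod_cast hm
  -- With this `s` the tail exponent at scale `k` is exactly `(c + 8) l 4^k`. Of the factor `c + 8`,
  -- a part 2 pays for the at most `exp (2 l 4^k)` vectors and a part 3 for the `2 (L + 1) ≤ m³` of
  -- the union over scales, leaving `c + 3`.
  set s := B * √(8 * (c + 8) * l) with hs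
  have hs0 : 0 ≤ s := by positivity
  set L := Nat.log 2 m + 1 with hL
  have hLm : m ≤ 2 ^ L := (Nat.lt_pow_succ_log_self (by norm_num) m).le
  have hsB : 2 * B ≤ s := by
    rw [hs, mul_comm]
    gcongr
    exact Real.le_sqrt_of_sq_le (by nlinarith)
  have hLl : (L : ℝ) ≤ 2 * l + 1 := by
    rw [hL]; push_cast; linarith [natLog_le_two_mul_log hm]
  have htotal : (L + 1) * s + 2 * B ≤ 12 * l * s := by nlinarith
  set A : ℕ → Set (E → Bool) := fun k => {ω | ∃ z ∈ natVecs P (4 ^ k),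
    ∑ e ∈ R, q e (scaledVec (B / 2 ^ k) z) ^ 2 ≤ 1 ∧
      s < |∑ e ∈ R, coinSign (ω e) * (q e (scaledVec (B / 2 ^ k) z) ^ 2
        - q e (scaledVec (B / 2 ^ k) (evenPart z)) ^ 2)|} with hA
  refine (measureReal_mono (s₂ := ⋃ k ∈ range (L + 1), A k) ?_ (measure_ne_top _ _)).trans
    ((measureReal_biUnion_finset_le (range (L + 1)) A).trans ?_)
  · rintro ω ⟨y, hy, hyP, hyB, hqy, hlt⟩
    by_contra hcon
    simp only [hA, Set.mem_iUnion, Set.mem_ofPred_eq, not_exists, mem_range, not_and, not_lt]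
      at hcon
    have := abs_signedSum_le_of_increments_le R q hq hB P (fun e => coinSign (ω e))
      (fun e => abs_coinSign_le _) hR L hLm (s := s)
      (fun k hk z hz h1 => hcon k (by omega) z hz h1) y hy hyP hyB hqy
    linarith
  calc ∑ k ∈ range (L + 1), (fairCoins E).real (A k)
      ≤ ∑ k ∈ range (L + 1), 2 * Real.exp (-((c + 6) * l)) := by
        refine Finset.sum_le_sum fun k _ => ?_
        refine (measure_increment_gt_le R q hq (by positivity) hs0 P (4 ^ k)).trans ?_
        have h4 : (4 : ℝ) ^ k = (2 ^ k) ^ 2 := by rw [← pow_mul, mul_comm, pow_mul]; norm_num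
        have hexp : s ^ 2 / (8 * (B / 2 ^ k) ^ 2) = (c + 8) * l * 4 ^ k := by
          rw [hs, mul_pow, Real.sq_sqrt (by positivity), h4]
          field_simp
        have hP2 : (#P + 1 : ℝ) ≤ Real.exp (2 * l) := by
          have h1 : (#P : ℝ) ≤ m := by exact_mod_cast hP
          rw [two_mul, Real.exp_add, ← hml]
          nlinarith
        rw [hexp]
        calc _ ≤ Real.exp (2 * l) ^ (4 ^ k) * (2 * Real.exp (-((c + 8) * l * 4 ^ k))) :=
              mul_le_mul_of_nonneg_right
                (pow_le_pow_left₀ (add_nonneg (Nat.cast_nonneg _) zero_le_one) hP2 _)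
                (mul_nonneg zero_le_two (Real.exp_pos _).le)
          _ = 2 * Real.exp (-((c + 6) * l * 4 ^ k)) := by
              rw [← Real.exp_nat_mul, mul_left_comm, ← Real.exp_add]
              congr 2
              rw [Nat.cast_pow, Nat.cast_ofNat]
              ring
          _ ≤ _ := by
              have h1 : (1 : ℝ) ≤ 4 ^ k := one_le_pow₀ (by norm_num)
              have h2 : 0 ≤ (c + 6) * l := by positivity
              have h3 : (c + 6) * l ≤ (c + 6) * l * 4 ^ k := le_mul_of_one_le_right h2 h1
              have h4 : Real.exp (-((c + 6) * l * 4 ^ k)) ≤ Real.exp (-((c + 6) * l)) :=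
                Real.exp_le_exp.mpr (neg_le_neg h3)
              linarith
    _ = (L + 1) * (2 * Real.exp (-((c + 6) * l))) := by
        rw [sum_const, nsmul_eq_mul, card_range]; push_cast; ring
    _ ≤ Real.exp (3 * l) * Real.exp (-((c + 6) * l)) := by
        have hlm : l ≤ m - 1 := Real.log_le_sub_one_of_pos hmpos
        have h3 : Real.exp (3 * l) = (m : ℝ) ^ 3 := by
          rw [hml, ← Real.exp_nat_mul]; norm_cast
        have h4 : 2 * ((L : ℝ) + 1) ≤ (m : ℝ) ^ 3 := by
          -- This is `4 m ≤ m³`, while `L + 1 ≤ 2 l + 2 ≤ 2 m`.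
          have h5 : 0 ≤ (m : ℝ) * (m ^ 2 - 4) := mul_nonneg hmpos.le (by nlinarith)
          nlinarith
        rw [h3]
        calc _ = 2 * ((L : ℝ) + 1) * Real.exp (-((c + 6) * l)) := by ring
          _ ≤ _ := by gcongr
    _ = _ := by rw [← Real.exp_add]; congr 1; ring

end Chaining

/-! ### Sampling outside a coreset -/

namespace DirHypergraph

open DecrementalCoresetAndSample

variable {V E : Type*}

/-- The contribution of the hyperedge `e` to the energy. -/
noncomputable def edgeEnergy (H : DirHypergraph V E) (e : E) (x : V → ℝ) : ℝ :=
  H.weight e * (H.tail e ×ˢ H.head e).sup' ((H.tail_nonempty e).product (H.head_nonempty e))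
    (fun p => (max (x p.1 - x p.2) 0) ^ 2)

theorem weight_mul_le_edgeEnergy (H : DirHypergraph V E) {e : E} {p : V × V}
    (hp : p ∈ H.tail e ×ˢ H.head e) (x : V → ℝ) :
    H.weight e * (max (x p.1 - x p.2) 0) ^ 2 ≤ H.edgeEnergy e x :=
  mul_le_mul_of_nonneg_left (le_sup' (fun p : V × V => (max (x p.1 - x p.2) 0) ^ 2) hp)
    (H.weight_nonneg e)

theorem edgeEnergy_nonneg (H : DirHypergraph V E) (e : E) (x : V → ℝ) : 0 ≤ H.edgeEnergy e x := by
  obtain ⟨p, hp⟩ := (H.tail_nonempty e).product (H.head_nonempty e)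
  exact (mul_nonneg (H.weight_nonneg e) (sq_nonneg _)).trans (H.weight_mul_le_edgeEnergy hp x)

theorem energy_eq_sum (H : DirHypergraph V E) (x : V → ℝ) :
    H.energy x = ∑ e ∈ H.edges, H.edgeEnergy e x := rfl

/-! ### Hyperedge energies as squares of maximum norms -/

theorem mul_sup'_sq_eq {α : Type*} {s : Finset α} (hs : s.Nonempty) {d g : α → ℝ} {w : ℝ}
    (hw : 0 ≤ w) (hd : ∀ p, 0 ≤ d p) (hg : ∀ p ∈ s, g p = √w * d p) :
    w * s.sup' hs (fun p => d p ^ 2) = (s.sup' hs g) ^ 2 := by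
  have hsq : ∀ p ∈ s, g p ^ 2 = w * d p ^ 2 := fun p hp => by
    rw [hg p hp, mul_pow, Real.sq_sqrt hw]
  have hg0 : ∀ p ∈ s, 0 ≤ g p := fun p hp => by
    rw [hg p hp]; exact mul_nonneg (Real.sqrt_nonneg _) (hd p)
  apply le_antisymm
  · obtain ⟨p, hp, h⟩ := exists_mem_eq_sup' hs (fun p => d p ^ 2)
    rw [h, ← hsq p hp]
    exact pow_le_pow_left₀ (hg0 p hp) (le_sup' g hp) 2
  · obtain ⟨p, hp, h⟩ := exists_mem_eq_sup' hs g
    rw [h, hsq p hp]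
    exact mul_le_mul_of_nonneg_left (le_sup' (fun p => d p ^ 2) hp) hw

theorem isMaxNormLike_sup' {α : Type*} {s : Finset α} (hs : s.Nonempty) {a : α → ℝ}
    (h0 : ∀ p, 0 ≤ a p) (h1 : ∀ p, a p ≤ 1) :
    IsMaxNormLike fun y : α → ℝ => s.sup' hs fun p => a p * y p where
  zero := by simp
  mono := fun y y' _ h => sup'_mono_fun fun p _ => mul_le_mul_of_nonneg_left (h p) (h0 p)
  lipschitz := fun y y' _ _ δ hδ h => sup'_le _ _ fun p hp => by
    have hle := le_sup' (fun p => a p * y p) hp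
    calc a p * y' p ≤ a p * (y p + δ) := mul_le_mul_of_nonneg_left (h p) (h0 p)
      _ ≤ a p * y p + δ := by nlinarith [h1 p]
      _ ≤ _ := add_le_add_left hle δ

variable [DecidableEq V] [DecidableEq E]

omit [DecidableEq E] in
theorem mem_pairEdges {H : DirHypergraph V E} {p : V × V} {e : E} :
    e ∈ H.pairEdges p ↔ e ∈ H.edges ∧ p ∈ H.tail e ×ˢ H.head e := by
  simp [pairEdges]

/-- The largest weight of a hyperedge of `E_{u,v}` outside `C`, or zero if there is none. -/
noncomputable def outerWeight (H : DirHypergraph V E) (C : Finset E) (p : V × V) : ℝ :=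
  if h : (H.pairEdges p \ C).Nonempty then (H.pairEdges p \ C).sup' h H.weight else 0

theorem outerWeight_nonneg (H : DirHypergraph V E) (C : Finset E) (p : V × V) :
    0 ≤ H.outerWeight C p := by
  unfold outerWeight
  split_ifs with h
  · obtain ⟨e, he⟩ := h
    exact (H.weight_nonneg e).trans (le_sup' _ he)
  · exact le_rfl

theorem weight_le_outerWeight {H : DirHypergraph V E} {C : Finset E} {p : V × V} {e : E}
    (he : e ∈ H.pairEdges p \ C) : H.weight e ≤ H.outerWeight C p := by
  rw [outerWeight, dif_pos ⟨e, he⟩]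
  exact le_sup' _ he

-- A sampled hyperedge contributes twice its energy and an unsampled one nothing; relative to its
-- energy, the error is the sign of its coin.
omit [DecidableEq V] in
theorem energy_coresetUnionSample_sub (H : DirHypergraph V E) {C : Finset E} (hC : C ⊆ H.edges)
    (ω : E → Bool) (x : V → ℝ) :
    (H.coresetUnionSample C ((H.edges \ C).filter fun e => ω e = true)).energy x - H.energy x
      = ∑ e ∈ H.edges \ C, coinSign (ω e) * H.edgeEnergy e x := by
  set S := (H.edges \ C).filter fun e => ω e = true
  have hdisj : Disjoint C S := disjoint_left.mpr fun e he heS =>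
    (mem_sdiff.mp (mem_filter.mp heS).1).2 he
  have h1 : (H.coresetUnionSample C S).energy x
      = ∑ e ∈ C, H.edgeEnergy e x + ∑ e ∈ S, 2 * H.edgeEnergy e x := by
    rw [energy_eq_sum]
    change ∑ e ∈ C ∪ S, _ = _
    rw [sum_union hdisj]
    congr 1
    · refine sum_congr rfl fun e he => ?_
      simp [edgeEnergy, coresetUnionSample, he]
    · refine sum_congr rfl fun e he => ?_
      have : e ∉ C := disjoint_right.mp hdisj he
      simp [edgeEnergy, coresetUnionSample, this, mul_assoc]
  rw [h1, energy_eq_sum, ← sum_sdiff hC, sum_filter]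
  have h2 : ∀ a b c : ℝ, a + b - (c + a) = b - c := fun a b c => by ring
  rw [h2, ← sum_sub_distrib]
  refine sum_congr rfl fun e _ => ?_
  cases ω e <;> simp [coinSign]
  ring

/-! ### Consequences of the coreset property -/

omit [DecidableEq E] in
theorem IsCoreset.subset {lam : ℕ} {H : DirHypergraph V E} {C : Finset E}
    (hC : H.IsCoreset lam C) : C ⊆ H.edges := by
  obtain ⟨D, -, hmem, hD, -⟩ := hC
  intro e he
  obtain ⟨p, hp⟩ := (hmem e).mp he
  exact (mem_pairEdges.mp ((hD p).1 hp)).1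

/-- The pairs `(u, v)` such that `E_{u,v}` has a member outside `C`. -/
noncomputable def outerPairs [Fintype V] (H : DirHypergraph V E) (C : Finset E) :
    Finset (V × V) :=
  univ.filter fun p => (H.pairEdges p \ C).Nonempty

/-- Every outer pair owns a nonempty `D p`, and these are disjoint. Hence the dimension in the
chaining is at most the number of hyperedges, and neither the number of vertices nor the rank enters
the error bound. -/
theorem IsCoreset.card_outerPairs_le [Fintype V] {lam : ℕ} {H : DirHypergraph V E}
    {C : Finset E} (hC : H.IsCoreset lam C) (hlam : 0 < lam) :
    #(H.outerPairs C) ≤ #H.edges := by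
  have hsub := hC.subset
  obtain ⟨D, hdisj, hmem, hD, hfull⟩ := hC
  calc #(H.outerPairs C) ≤ ∑ p ∈ H.outerPairs C, #(D p) := by
        rw [card_eq_sum_ones]
        refine sum_le_sum fun p hp => ?_
        obtain ⟨e, he⟩ := (mem_filter.mp hp).2
        rw [(hfull p e (mem_sdiff.mp he).1 (mem_sdiff.mp he).2).1]
        exact hlam
    _ = #((H.outerPairs C).biUnion D) :=
        (card_biUnion fun p _ q _ hpq => hdisj p q hpq).symm
    _ ≤ #H.edges := card_le_card (biUnion_subset.mpr fun p _ e he =>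
        (mem_pairEdges.mp ((hD p).1 he)).1)

theorem IsCoreset.card_le [Fintype V] {lam : ℕ} {H : DirHypergraph V E} {C : Finset E}
    (hC : H.IsCoreset lam C) : #C ≤ Fintype.card V ^ 2 * lam := by
  obtain ⟨D, hdisj, hmem, hD, hfull⟩ := hC
  calc #C ≤ #((univ : Finset (V × V)).biUnion D) := card_le_card fun e he => by
        obtain ⟨p, hp⟩ := (hmem e).mp he
        exact mem_biUnion.mpr ⟨p, mem_univ _, hp⟩
    _ ≤ ∑ p : V × V, #(D p) := card_biUnion_le
    _ ≤ ∑ _p : V × V, lam := sum_le_sum fun p _ => (hD p).2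
    _ = _ := by simp [Fintype.card_prod, sq]

/-- Each of the `lam` members of `D p` weighs at least `outerWeight C p` and has `p` among its
pairs; by disjointness each hyperedge is charged for one pair only. -/
theorem IsCoreset.sum_outerWeight_le_energy [Fintype V] {lam : ℕ} {H : DirHypergraph V E}
    {C : Finset E} (hC : H.IsCoreset lam C) (x : V → ℝ) :
    lam * ∑ p ∈ H.outerPairs C, H.outerWeight C p * (max (x p.1 - x p.2) 0) ^ 2
      ≤ H.energy x := by
  obtain ⟨D, hdisj, hmem, hD, hfull⟩ := hC
  calc _ ≤ ∑ p ∈ H.outerPairs C, ∑ e ∈ D p, H.edgeEnergy e x := by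
        rw [mul_sum]
        refine sum_le_sum fun p hp => ?_
        have hne := (mem_filter.mp hp).2
        have hcard : #(D p) = lam := by
          obtain ⟨e, he⟩ := hne
          exact (hfull p e (mem_sdiff.mp he).1 (mem_sdiff.mp he).2).1
        rw [← hcard, ← nsmul_eq_mul, ← sum_const]
        refine sum_le_sum fun e he => ?_
        refine le_trans ?_
          (H.weight_mul_le_edgeEnergy (mem_pairEdges.mp ((hD p).1 he)).2 x)
        refine mul_le_mul_of_nonneg_right ?_ (sq_nonneg _)
        rw [outerWeight, dif_pos hne]
        exact sup'_le _ _ fun f hf =>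
          (hfull p f (mem_sdiff.mp hf).1 (mem_sdiff.mp hf).2).2 e he
    _ = ∑ e ∈ (H.outerPairs C).biUnion D, H.edgeEnergy e x :=
        (sum_biUnion fun p _ q _ hpq => hdisj p q hpq).symm
    _ ≤ H.energy x := by
        rw [energy_eq_sum]
        exact sum_le_sum_of_subset_of_nonneg (biUnion_subset.mpr fun p _ e he =>
          (mem_pairEdges.mp ((hD p).1 he)).1) fun e _ _ => H.edgeEnergy_nonneg e x

/-- The square root of the energy of a hyperedge, as a function of the normalized differences. -/
noncomputable def edgeNorm (H : DirHypergraph V E) (C : Finset E) (e : E) (y : V × V → ℝ) : ℝ :=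
  (H.tail e ×ˢ H.head e).sup' ((H.tail_nonempty e).product (H.head_nonempty e))
    fun p => min 1 √(H.weight e / H.outerWeight C p) * y p

/-- The cap `min 1` gives the Lipschitz constant one for every `e`, including members of `C`, which
may exceed the outer weight. -/
theorem isMaxNormLike_edgeNorm (H : DirHypergraph V E) (C : Finset E) (e : E) :
    IsMaxNormLike (H.edgeNorm C e) :=
  isMaxNormLike_sup' _ (fun _ => le_min zero_le_one (Real.sqrt_nonneg _)) fun _ => min_le_left _ _

/-- Outside `C` the cap is inactive because the weight of `e` is at most the outer weight of each of
its pairs; the outer weights then cancel. -/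
theorem edgeNorm_sq (H : DirHypergraph V E) {C : Finset E} {e : E} (he : e ∈ H.edges \ C)
    (x : V → ℝ) {Q : ℝ} (hQ : 0 < Q) :
    H.edgeNorm C e (fun p => √(H.outerWeight C p) * max (x p.1 - x p.2) 0 / √Q) ^ 2
      = H.edgeEnergy e x / Q := by
  rw [edgeNorm, ← mul_sup'_sq_eq (w := H.weight e / Q) (d := fun p => max (x p.1 - x p.2) 0) _
    (div_nonneg (H.weight_nonneg e) hQ.le) (fun _ => le_max_right _ _), edgeEnergy]
  · ring
  · intro p hp
    have hle : H.weight e ≤ H.outerWeight C p := weight_le_outerWeight (by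
      simp only [mem_sdiff] at he ⊢
      exact ⟨mem_pairEdges.mpr ⟨he.1, hp⟩, he.2⟩)
    have hmin : min 1 √(H.weight e / H.outerWeight C p)
        = √(H.weight e / H.outerWeight C p) :=
      min_eq_right (Real.sqrt_le_one.mpr (div_le_one_of_le₀ hle (H.outerWeight_nonneg C p)))
    rw [hmin, Real.sqrt_div (H.weight_nonneg e), Real.sqrt_div (H.weight_nonneg e)]
    -- If the outer weight is zero, the quotient has the default value 0, which is correct since `e`
    -- then has weight zero.
    rcases (H.outerWeight_nonneg C p).eq_or_lt with h0 | h0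
    · have : H.weight e = 0 := le_antisymm (h0 ▸ hle) (H.weight_nonneg e)
      simp [this]
    · have := Real.sqrt_pos.mpr h0
      field_simp

/-- Keeping a coreset and sampling the other hyperedges gives a sparsifier with high
probability. -/
theorem measure_not_isSpectralHypersparsifier_le {V E : Type} [DecidableEq V] [DecidableEq E]
    [Fintype V] [Fintype E] {H : DirHypergraph V E} {C : Finset E} {lam m : ℕ} {ε c : ℝ}
    (hC : H.IsCoreset lam C) (hlam : 0 < lam) (hm : 2 ≤ m) (hHm : #H.edges ≤ m) (hc : 0 ≤ c)
    (hε : 12 * Real.log m * ((√lam)⁻¹ * √(8 * (c + 8) * Real.log m)) ≤ ε) :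
    (fairCoins E).real {ω | ¬ IsSpectralHypersparsifier ε
        (H.coresetUnionSample C ((H.edges \ C).filter fun e => ω e = true)) H}
      ≤ Real.exp (-((c + 3) * Real.log m)) := by
  have hlam' : (0 : ℝ) < lam := by exact_mod_cast hlam
  refine (measureReal_mono ?_ (measure_ne_top _ _)).trans
    (measure_exists_abs_signedSum_gt_le (H.edges \ C) (H.edgeNorm C)
      (H.isMaxNormLike_edgeNorm C) (B := (√lam)⁻¹) (by positivity) hc (H.outerPairs C) hm
      ((card_le_card sdiff_subset).trans hHm) ((hC.card_outerPairs_le hlam).trans hHm))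
  intro ω hω
  simp only [Set.mem_ofPred_eq, IsSpectralHypersparsifier, not_forall] at hω
  obtain ⟨x, hx⟩ := hω
  have hdiff := H.energy_coresetUnionSample_sub hC.subset ω x
  set S := (H.edges \ C).filter fun e => ω e = true
  have hRle : ∑ e ∈ H.edges \ C, H.edgeEnergy e x ≤ H.energy x :=
    sum_le_sum_of_subset_of_nonneg sdiff_subset fun e _ _ => H.edgeEnergy_nonneg e x
  have hQ0 : 0 ≤ H.energy x := sum_nonneg fun e _ => H.edgeEnergy_nonneg e x
  have habs : ε * H.energy x < |∑ e ∈ H.edges \ C, coinSign (ω e) * H.edgeEnergy e x| := by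
    by_contra hcon
    rw [not_lt, ← hdiff, abs_le] at hcon
    exact hx ⟨by linarith [hcon.1], by linarith [hcon.2]⟩
  -- Zero energy would make both sides of the strict inequality `habs` zero.
  have hQ : 0 < H.energy x := by
    refine hQ0.lt_of_ne fun h0 => ?_
    have hz : ∀ e ∈ H.edges \ C, H.edgeEnergy e x = 0 := by
      rw [← sum_eq_zero_iff_of_nonneg fun e _ => H.edgeEnergy_nonneg e x]
      exact le_antisymm (h0 ▸ hRle) (sum_nonneg fun e _ => H.edgeEnergy_nonneg e x)
    rw [sum_eq_zero fun e he => by rw [hz e he, mul_zero], ← h0] at habs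
    simp at habs
  refine ⟨fun p => √(H.outerWeight C p) * max (x p.1 - x p.2) 0 / √(H.energy x), ?_, ?_, ?_, ?_, ?_⟩
  · intro p
    simp only [Pi.zero_apply]
    positivity
  · intro p hp
    have : H.outerWeight C p = 0 := by
      rw [outerWeight, dif_neg]
      simpa [outerPairs] using hp
    simp [this]
  · have h := hC.sum_outerWeight_le_energy x
    have h2 : ∑ p ∈ H.outerPairs C,
        (√(H.outerWeight C p) * max (x p.1 - x p.2) 0 / √(H.energy x)) ^ 2
        = (∑ p ∈ H.outerPairs C, H.outerWeight C p * (max (x p.1 - x p.2) 0) ^ 2)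
          / H.energy x := by
      rw [sum_div]
      refine sum_congr rfl fun p _ => ?_
      rw [div_pow, mul_pow, Real.sq_sqrt (H.outerWeight_nonneg C p), Real.sq_sqrt hQ0]
    rw [h2, inv_pow, Real.sq_sqrt hlam'.le, div_le_iff₀ hQ, ← div_eq_inv_mul, le_div_iff₀ hlam']
    linarith
  · rw [sum_congr rfl fun e he => H.edgeNorm_sq he x hQ, ← sum_div]
    exact (div_le_one hQ).mpr hRle
  · rw [sum_congr rfl fun e he => by rw [H.edgeNorm_sq he x hQ, ← mul_div_assoc], ← sum_div,
      abs_div, abs_of_pos hQ, lt_div_iff₀ hQ]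
    exact (mul_le_mul_of_nonneg_right hε hQ0).trans_lt habs

end DirHypergraph

/-! ### Values of timed computations -/

namespace Timed

universe u v

@[simp] theorem val_bind {α β : Type u} (x : Timed α) (f : α → Timed β) :
    (x >>= f).val = (f x.val).val := rfl

@[simp] theorem time_bind {α β : Type u} (x : Timed α) (f : α → Timed β) :
    (x >>= f).time = x.time + (f x.val).time := rfl

@[simp] theorem val_step {α : Type u} (a : α) : (step a).val = a := rfl

@[simp] theorem time_step {α : Type u} (a : α) : (step a).time = 1 := rfl

@[simp] theorem val_read {α : Type v} {β : Type u} (T : α → β) (a : α) : (read T a).val = T a := rfl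

@[simp] theorem time_read {α : Type v} {β : Type u} (T : α → β) (a : α) : (read T a).time = 1 := rfl

@[simp] theorem val_write {α : Type v} {β : Type u} [DecidableEq α] (T : α → β) (a : α) (b : β) :
    (write T a b).val = Function.update T a b := rfl

@[simp] theorem time_write {α : Type v} {β : Type u} [DecidableEq α] (T : α → β) (a : α) (b : β) :
    (write T a b).time = 1 := rfl

theorem val_forEach {α : Type v} {σ : Type u} (f : α → σ → Timed σ) (l : List α) (s : σ) :
    (forEach f l s).val = l.foldl (fun s a => (f a s).val) s := by
  induction l generalizing s with
  | nil => rfl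
  | cons a l ih => exact ih _

theorem split_perm {α : Type u} (l : List α) :
    ((split l).val.1 ++ (split l).val.2).Perm l := by
  induction l using split.induct with
  | case1 => simp [split]
  | case2 a => simp [split]
  | case3 a b l ih =>
    simp only [split, val_bind, val_step, List.cons_append, List.perm_cons]
    exact List.perm_middle.trans (ih.cons b)

theorem length_split {α : Type u} (l : List α) :
    (split l).val.1.length = (l.length + 1) / 2 ∧ (split l).val.2.length = l.length / 2 := by
  induction l using split.induct with
  | case1 => simp [split]
  | case2 a => simp [split]
  | case3 a b l ih =>
    simp only [split, val_bind, val_step, List.length_cons, ih.1, ih.2]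
    omega

theorem val_merge {α : Type u} (le : α → α → Bool) (l l' : List α) :
    (merge le l l').val = List.merge l l' le := by
  induction l, l' using merge.induct le with
  | case1 l => simp [merge]
  | case2 a l => simp [merge]
  | case3 a l b l' h ih =>
    rw [merge, if_pos h, val_bind, val_step, ih, List.merge, if_pos h]
  | case4 a l b l' h ih =>
    rw [merge, if_neg h, val_bind, val_step, ih, List.merge, if_neg h]

theorem mergeSort_perm {α : Type u} (le : α → α → Bool) (k : ℕ) (l : List α) :
    (mergeSort le k l).val.Perm l := by
  induction k generalizing l with
  | zero => simp [mergeSort]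
  | succ k ih =>
    match l with
    | [] => simp [mergeSort]
    | [a] => simp [mergeSort]
    | a :: b :: l =>
      simp only [mergeSort, val_bind, val_merge]
      exact (List.merge_perm_append _).trans (((ih _).append (ih _)).trans (split_perm _))

theorem mergeSort_pairwise {α : Type u} (w : α → ℝ) (k : ℕ) (l : List α) (hk : l.length ≤ k) :
    (mergeSort (fun a b => decide (w a ≤ w b)) k l).val.Pairwise fun a b => w a ≤ w b := by
  induction k generalizing l with
  | zero => simp [mergeSort, List.length_eq_zero_iff.mp (Nat.le_zero.mp hk)]
  | succ k ih =>
    match l with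
    | [] => simp [mergeSort]
    | [a] => simp [mergeSort]
    | a :: b :: l =>
      simp only [mergeSort, val_bind, val_merge]
      have hs := length_split (a :: b :: l)
      simp only [List.length_cons] at hs hk
      have h1 := ih (split (a :: b :: l)).val.1 (by omega)
      have h2 := ih (split (a :: b :: l)).val.2 (by omega)
      have := List.pairwise_merge (le := fun a b => decide (w a ≤ w b))
        (fun a b c hab hbc => by simp only [decide_eq_true_eq] at *; exact hab.trans hbc)
        (fun a b => by simpa using le_total (w a) (w b)) _ _
        (by simpa using h1) (by simpa using h2)
      simpa using this

end Timed

namespace CoresetDS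

variable {V E : Type*}

/-- `e` is a member of `E_{u,v}` outside the coreset. -/
def Avail (s : CoresetDS V E) (p : V × V) (e : E) : Prop :=
  s.inE (p.1, p.2, e) = true ∧ s.inC e = false

/-- The members of the coreset that were added from `E_{u,v}`. -/
def part [Fintype E] [DecidableEq V] (s : CoresetDS V E) (p : V × V) : Finset E :=
  univ.filter fun e => s.inC e = true ∧ s.source e = some p

theorem mem_part [Fintype E] [DecidableEq V] {s : CoresetDS V E} {p : V × V} {e : E} :
    e ∈ s.part p ↔ s.inC e = true ∧ s.source e = some p := by
  simp [part]

end CoresetDS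

namespace DecrementalCoresetAndSample

open Timed CoresetDS

variable {V E : Type} [LinearOrder V] [LinearOrder E]

/-! ### Moving heaviest hyperedges to the coreset -/

omit [LinearOrder V] [LinearOrder E] in
theorem scan_cases (s : CoresetDS V E) (u v : V) (q : List E) :
    ((scan s u v q).val = (none, []) ∧ ∀ e ∈ q, ¬ s.Avail (u, v) e) ∨
    ∃ q₀ e q₁, q = q₀ ++ e :: q₁ ∧ (scan s u v q).val = (some e, q₁) ∧ s.Avail (u, v) e ∧
      ∀ f ∈ q₀, ¬ s.Avail (u, v) f := by
  induction q with
  | nil => exact Or.inl ⟨rfl, by simp⟩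
  | cons e q ih =>
    by_cases h : s.Avail (u, v) e
    · refine Or.inr ⟨[], e, q, rfl, ?_, h, by simp⟩
      simp [scan, h.1, h.2]
    · have hval : (scan s u v (e :: q)).val = (scan s u v q).val := by
        have : (s.inE (u, v, e) && !s.inC e) = false := by
          simp only [Avail] at h
          cases h1 : s.inE (u, v, e) <;> cases h2 : s.inC e <;> simp_all
        simp only [scan, val_bind, val_read, this, Bool.false_eq_true, if_false, val_step]
      rw [hval]
      rcases ih with ⟨h1, h2⟩ | ⟨q₀, f, q₁, h1, h2, h3, h4⟩
      · exact Or.inl ⟨h1, by simpa [h] using h2⟩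
      · exact Or.inr ⟨e :: q₀, f, q₁, by simp [h1], h2, h3, by simpa [h] using h4⟩

theorem addHeaviest_cases (u v : V) (s : CoresetDS V E) :
    ((addHeaviest u v s).val = ({ s with queue := Function.update s.queue (u, v) [] }, false) ∧
      ∀ e ∈ s.queue (u, v), ¬ s.Avail (u, v) e) ∨
    ∃ q₀ e q₁, s.queue (u, v) = q₀ ++ e :: q₁ ∧
      (addHeaviest u v s).val = ({ s with
        queue := Function.update s.queue (u, v) q₁
        inC := Function.update s.inC e true
        source := Function.update s.source e (some (u, v))
        inS := Function.update s.inS e false }, true) ∧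
      s.Avail (u, v) e ∧ ∀ f ∈ q₀, ¬ s.Avail (u, v) f := by
  rcases scan_cases s u v (s.queue (u, v)) with ⟨h1, h2⟩ | ⟨q₀, e, q₁, h1, h2, h3, h4⟩
  · refine Or.inl ⟨?_, h2⟩
    simp [addHeaviest, h1]
  · refine Or.inr ⟨q₀, e, q₁, h1, ?_, h3, h4⟩
    simp [addHeaviest, h2]

/-- The tables describe the sets `E_{u,v}` of the present hyperedges `A`, and every hyperedge of
the coreset was a heaviest choice. -/
structure Consistent (H : DirHypergraph V E) (A : Finset E) (s : CoresetDS V E) : Prop where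
  inE_iff : ∀ u v e, s.inE (u, v, e) = true ↔ e ∈ A ∧ u ∈ H.tail e ∧ v ∈ H.head e
  sorted : ∀ p, (s.queue p).Pairwise fun e f => H.weight f ≤ H.weight e
  mem_queue : ∀ p e, s.Avail p e → e ∈ s.queue p
  source : ∀ e, s.inC e = true → ∃ p, s.source e = some p ∧ s.inE (p.1, p.2, e) = true
  heaviest : ∀ p e f, s.inC f = true → s.source f = some p → s.Avail p e →
    H.weight e ≤ H.weight f

/-- The sample consists of the present hyperedges outside the coreset with a successful coin. -/
def SampleCorrect (ω : E → Bool) (A : Finset E) (s : CoresetDS V E) : Prop :=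
  ∀ e, s.inS e = true ↔ e ∈ A ∧ s.inC e = false ∧ ω e = true

/-- The coreset has at most `lam` members from `E_{u,v}`, and exactly `lam` if some member of
`E_{u,v}` is outside the coreset. -/
def Full [Fintype E] (lam : ℕ) (s : CoresetDS V E) (p : V × V) : Prop :=
  #(s.part p) ≤ lam ∧ ∀ e, s.Avail p e → #(s.part p) = lam

variable {H : DirHypergraph V E} {A : Finset E} {s : CoresetDS V E}

/-- Discarding the scanned prefix is safe: it holds only unavailable hyperedges and the chosen one,
which becomes unavailable. The queue is sorted and contains all available hyperedges, so the first
available entry is a heaviest one. -/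
theorem Consistent.addHeaviest (hs : Consistent H A s) (u v : V) :
    Consistent H A (addHeaviest u v s).val.1 := by
  rcases addHeaviest_cases u v s with ⟨h1, h2⟩ | ⟨q₀, e, q₁, h1, h2, h3, h4⟩
  · rw [h1]
    refine ⟨hs.inE_iff, fun p => ?_, fun p e hp => ?_, hs.source, hs.heaviest⟩
    · by_cases hp : p = (u, v)
      · subst hp; simp
      · simpa [Function.update_of_ne hp] using hs.sorted p
    · by_cases hpp : p = (u, v)
      · subst hpp
        exact absurd hp (h2 e (hs.mem_queue _ e hp))
      · simpa [Function.update_of_ne hpp] using hs.mem_queue p e hp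
  · rw [h2]
    have hsort := hs.sorted (u, v)
    rw [h1, List.pairwise_append, List.pairwise_cons] at hsort
    have hne : ∀ f, Function.update s.inC e true f = false → f ≠ e := by
      rintro f hf rfl
      simp at hf
    have hq₁ : ∀ f, s.inE (u, v, f) = true → Function.update s.inC e true f = false →
        f ∈ q₁ := fun f hf hfC => by
      have hfe := hne f hfC
      rw [Function.update_of_ne hfe] at hfC
      have := hs.mem_queue (u, v) f ⟨hf, hfC⟩
      rw [h1, List.mem_append, List.mem_cons] at this
      rcases this with h | h | h
      · exact absurd ⟨hf, hfC⟩ (h4 f h)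
      · exact absurd h hfe
      · exact h
    refine ⟨hs.inE_iff, fun p => ?_, fun p f hp => ?_, fun f hf => ?_, fun p f g hg hgp hf => ?_⟩
    · by_cases hp : p = (u, v)
      · subst hp; simpa using hsort.2.1.2
      · simpa [Function.update_of_ne hp] using hs.sorted p
    · by_cases hpp : p = (u, v)
      · subst hpp
        simpa using hq₁ f hp.1 hp.2
      · have hf := hne f hp.2
        simpa [Function.update_of_ne hpp] using
          hs.mem_queue p f ⟨hp.1, by simpa [Function.update_of_ne hf] using hp.2⟩
    · by_cases hfe : f = e
      · subst hfe
        exact ⟨(u, v), by simp, h3.1⟩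
      · simp only [Function.update_of_ne hfe] at hf ⊢
        exact hs.source f hf
    · have hfe := hne f hf.2
      by_cases hge : g = e
      · subst hge
        simp only [Function.update_self, Option.some.injEq] at hgp
        subst hgp
        exact hsort.2.1.1 f (hq₁ f hf.1 hf.2)
      · simp only [Function.update_of_ne hge] at hg hgp
        exact hs.heaviest p f g hg hgp ⟨hf.1, by simpa [Function.update_of_ne hfe] using hf.2⟩

theorem avail_of_avail_addHeaviest {u v : V} {p : V × V} {e : E}
    (h : (addHeaviest u v s).val.1.Avail p e) : s.Avail p e := by
  rcases addHeaviest_cases u v s with ⟨h1, -⟩ | ⟨q₀, f, q₁, -, h2, -, -⟩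
  · rwa [h1] at h
  · rw [h2] at h
    refine ⟨h.1, ?_⟩
    have h' := h.2
    by_cases hf : e = f
    · subst hf; simp at h'
    · simpa [Function.update_of_ne hf] using h'

theorem SampleCorrect.addHeaviest {ω : E → Bool} (hs : SampleCorrect ω A s) (u v : V) :
    SampleCorrect ω A (addHeaviest u v s).val.1 := by
  rcases addHeaviest_cases u v s with ⟨h1, -⟩ | ⟨q₀, f, q₁, -, h2, -, -⟩
  · rw [h1]; exact hs
  · rw [h2]
    intro e
    by_cases hf : e = f
    · subst hf; simp
    · simpa [Function.update_of_ne hf] using hs e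

theorem inS_addHeaviest_eq_false {u v : V} (hs : ∀ e, s.inS e = false) (e : E) :
    (addHeaviest u v s).val.1.inS e = false := by
  rcases addHeaviest_cases u v s with ⟨h1, -⟩ | ⟨q₀, f, q₁, -, h2, -, -⟩
  · rw [h1]; exact hs e
  · rw [h2]
    by_cases hf : e = f
    · subst hf; simp
    · simpa [Function.update_of_ne hf] using hs e

/-- Either there was nothing to add, or one hyperedge was added to the coreset. -/
theorem part_addHeaviest [Fintype E] (hs : Consistent H A s) (u v : V) :
    ((addHeaviest u v s).val.2 = false ∧ (∀ p, (addHeaviest u v s).val.1.part p = s.part p) ∧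
      ∀ e, ¬ (addHeaviest u v s).val.1.Avail (u, v) e) ∨
    ((addHeaviest u v s).val.2 = true ∧ ∃ e, s.inC e = false ∧
      (addHeaviest u v s).val.1.part (u, v) = insert e (s.part (u, v)) ∧
      ∀ p ≠ (u, v), (addHeaviest u v s).val.1.part p = s.part p) := by
  rcases addHeaviest_cases u v s with ⟨h1, h2⟩ | ⟨q₀, e, q₁, -, h2, h3, -⟩
  · refine Or.inl ⟨by rw [h1], fun p => by rw [h1]; rfl, fun e he => ?_⟩
    rw [h1] at he
    exact h2 e (hs.mem_queue _ e he) he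
  · refine Or.inr ⟨by rw [h2], e, h3.2, ?_, fun p hp => ?_⟩
    · rw [h2]
      ext f
      by_cases hf : f = e
      · subst hf; simp [mem_part]
      · simp [mem_part, hf]
    · rw [h2]
      ext f
      by_cases hf : f = e
      · subst hf; simp [mem_part, h3.2, hp.symm]
      · simp [mem_part, hf]

theorem addHeaviestMany_spec [Fintype E] (k : ℕ) (u v : V) (hs : Consistent H A s)
    (hS : ∀ e, s.inS e = false) :
    Consistent H A (addHeaviestMany k u v s).val ∧
    (∀ e, (addHeaviestMany k u v s).val.inS e = false) ∧
    (∀ p ≠ (u, v), (addHeaviestMany k u v s).val.part p = s.part p) ∧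
    (∀ p e, (addHeaviestMany k u v s).val.Avail p e → s.Avail p e) ∧
    #((addHeaviestMany k u v s).val.part (u, v)) ≤ #(s.part (u, v)) + k ∧
    ∀ e, (addHeaviestMany k u v s).val.Avail (u, v) e →
      #((addHeaviestMany k u v s).val.part (u, v)) = #(s.part (u, v)) + k := by
  induction k generalizing s with
  | zero => exact ⟨hs, hS, fun _ _ => rfl, fun _ _ h => h, le_rfl, fun _ _ => rfl⟩
  | succ k ih =>
    rcases part_addHeaviest hs u v with ⟨h1, h2, h3⟩ | ⟨h1, e, h2, h3, h4⟩
    · have hval : (addHeaviestMany (k + 1) u v s).val = (addHeaviest u v s).val.1 := by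
        simp [addHeaviestMany, h1]
      rw [hval]
      exact ⟨hs.addHeaviest u v, inS_addHeaviest_eq_false hS, fun p _ => h2 p,
        fun p e => avail_of_avail_addHeaviest, by rw [h2]; omega, fun e he => absurd he (h3 e)⟩
    · have hval : (addHeaviestMany (k + 1) u v s).val
          = (addHeaviestMany k u v (addHeaviest u v s).val.1).val := by
        simp [addHeaviestMany, h1]
      have hcard : #((addHeaviest u v s).val.1.part (u, v)) = #(s.part (u, v)) + 1 := by
        rw [h3, card_insert_of_notMem]
        simp [mem_part, h2]
      rw [hval]
      obtain ⟨i1, i2, i3, i4, i5, i6⟩ := ih (hs.addHeaviest u v) (inS_addHeaviest_eq_false hS)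
      exact ⟨i1, i2, fun p hp => (i3 p hp).trans (h4 p hp),
        fun p e he => avail_of_avail_addHeaviest (i4 p e he), by omega,
        fun e he => by rw [i6 e he]; omega⟩

/-- Later pairs only shrink availability and leave the part of an earlier pair alone, so a full pair
stays full. Absence of duplicates ensures that each part starts empty when its turn comes. -/
theorem foldl_addHeaviestMany_spec [Fintype E] (lam : ℕ) (l : List (V × V)) (hl : l.Nodup)
    (hs : Consistent H A s) (hS : ∀ e, s.inS e = false) (hempty : ∀ p ∈ l, s.part p = ∅)
    (hfull : ∀ p ∉ l, Full lam s p) :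
    let s' := l.foldl (fun s p => (addHeaviestMany lam p.1 p.2 s).val) s
    Consistent H A s' ∧ (∀ e, s'.inS e = false) ∧ ∀ p, Full lam s' p := by
  induction l generalizing s with
  | nil => exact ⟨hs, hS, fun p => hfull p (by simp)⟩
  | cons a l ih =>
    obtain ⟨i1, i2, i3, i4, i5, i6⟩ := addHeaviestMany_spec lam a.1 a.2 hs hS
    rw [List.nodup_cons] at hl
    have ha : #(s.part (a.1, a.2)) = 0 := by rw [hempty a (by simp)]; rfl
    refine ih hl.2 i1 i2 (fun p hp => ?_) fun p hp => ?_
    · rw [i3 p (fun h => hl.1 (by rwa [h] at hp))]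
      exact hempty p (by simp [hp])
    · by_cases hpa : p = a
      · subst hpa
        exact ⟨by simpa [ha] using i5, fun e he => by simpa [ha] using i6 e he⟩
      · have := hfull p (by simp [hpa, hp])
        refine ⟨by rw [i3 p hpa]; exact this.1, fun e he => ?_⟩
        rw [i3 p hpa]
        exact this.2 e (i4 p e he)

/-! ### Building the sets `E_{u,v}` -/

omit [LinearOrder E] in
theorem val_forEachPair (H : DirHypergraph V E) (e : E)
    (f : V → V → CoresetDS V E → Timed (CoresetDS V E)) (s : CoresetDS V E) :
    (forEachPair H e f s).val = ((H.tail e).sort (· ≤ ·) ×ˢ (H.head e).sort (· ≤ ·)).foldl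
      (fun s p => (f p.1 p.2 s).val) s := by
  simp only [forEachPair, val_forEach, SProd.sprod, List.product, List.foldl_flatMap,
    List.foldl_map]

omit [LinearOrder E] in
theorem mem_sort_product (H : DirHypergraph V E) (e : E) (p : V × V) :
    p ∈ (H.tail e).sort (· ≤ ·) ×ˢ (H.head e).sort (· ≤ ·) ↔ p ∈ H.tail e ×ˢ H.head e := by
  exact (List.pair_mem_product (x := p.1) (y := p.2)).trans (by simp [mem_product])

omit [LinearOrder E] in
theorem nodup_sort_product (H : DirHypergraph V E) (e : E) :
    ((H.tail e).sort (· ≤ ·) ×ˢ (H.head e).sort (· ≤ ·)).Nodup :=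
  ((H.tail e).sort_nodup _).product ((H.head e).sort_nodup _)

/-- The list of pairs contains the pairs with nonempty queue, each of them once. -/
def PairsCorrect (s : CoresetDS V E) : Prop :=
  s.pairs.Nodup ∧ ∀ p, p ∈ s.pairs ↔ s.queue p ≠ []

theorem val_push (e : E) (u v : V) (s : CoresetDS V E) :
    (push e u v s).val = { s with
      queue := Function.update s.queue (u, v) (e :: s.queue (u, v))
      inE := Function.update s.inE (u, v, e) true
      pairs := if s.queue (u, v) = [] then (u, v) :: s.pairs else s.pairs } := by
  simp only [push, val_bind, val_read, val_write]
  cases h : s.queue (u, v) <;> simp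

theorem PairsCorrect.push (hs : PairsCorrect s) (e : E) (u v : V) :
    PairsCorrect (push e u v s).val := by
  rw [val_push]
  refine ⟨?_, fun p => ?_⟩
  · by_cases h : s.queue (u, v) = []
    · simp only [h, if_true, List.nodup_cons]
      exact ⟨fun hmem => (hs.2 _).mp hmem h, hs.1⟩
    · simpa only [h, if_false] using hs.1
  · by_cases hp : p = (u, v)
    · subst hp
      by_cases h : s.queue (u, v) = []
      · simp [h]
      · simp [h, hs.2]
    · by_cases h : s.queue (u, v) = []
      · simp [h, hs.2, hp]
      · simp [h, hs.2, hp]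

theorem foldl_push_spec (e : E) (l : List (V × V)) (hl : l.Nodup) (s : CoresetDS V E)
    (hs : PairsCorrect s) :
    let s' := l.foldl (fun s p => (push e p.1 p.2 s).val) s
    PairsCorrect s' ∧ s'.inC = s.inC ∧ s'.inS = s.inS ∧
    (∀ p, s'.queue p = if p ∈ l then e :: s.queue p else s.queue p) ∧
    ∀ u v f, s'.inE (u, v, f) = true ↔ (f = e ∧ (u, v) ∈ l) ∨ s.inE (u, v, f) = true := by
  induction l generalizing s with
  | nil => exact ⟨hs, rfl, rfl, fun p => by simp, fun u v f => by simp⟩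
  | cons a l ih =>
    rw [List.nodup_cons] at hl
    obtain ⟨i1, i2, i3, i4, i5⟩ := ih hl.2 (push e a.1 a.2 s).val (hs.push e a.1 a.2)
    refine ⟨i1, i2.trans (by rw [val_push]), i3.trans (by rw [val_push]), fun p => ?_,
      fun u v f => ?_⟩
    · rw [List.foldl_cons, i4, val_push]
      by_cases hp : p = a
      · subst hp; simp [hl.1]
      · simp [hp]
    · rw [List.foldl_cons, i5, val_push]
      by_cases hp : (u, v, f) = (a.1, a.2, e)
      · obtain ⟨rfl, rfl, rfl⟩ : u = a.1 ∧ v = a.2 ∧ f = e := by simpa using hp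
        simp
      · simp only [Function.update_of_ne hp, List.mem_cons]
        have : ¬ (f = e ∧ (u, v) = a) := fun h => hp (by rw [h.1, ← h.2])
        tauto

/-- The state while the sets `E_{u,v}` are built, when the hyperedges in `B` have been inserted. -/
structure BuiltUpTo (H : DirHypergraph V E) (B : List E) (s : CoresetDS V E) : Prop where
  pairs : PairsCorrect s
  inC : ∀ e, s.inC e = false
  inS : ∀ e, s.inS e = false
  inE_iff : ∀ u v e, s.inE (u, v, e) = true ↔ e ∈ B ∧ u ∈ H.tail e ∧ v ∈ H.head e
  mem_queue : ∀ p e, e ∈ s.queue p ↔ e ∈ B ∧ p.1 ∈ H.tail e ∧ p.2 ∈ H.head e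
  sorted : ∀ p, (s.queue p).Pairwise fun e f => H.weight f ≤ H.weight e

/-- Pushing to the front in increasing order of weight leaves every queue in decreasing order. -/
theorem builtUpTo_forEach_push (H : DirHypergraph V E) (l B : List E) (s : CoresetDS V E)
    (hs : BuiltUpTo H B s) (hl : (B ++ l).Pairwise fun e f => H.weight e ≤ H.weight f) :
    BuiltUpTo H (B ++ l) (l.foldl (fun s e => (forEachPair H e (push e) s).val) s) := by
  induction l generalizing B s with
  | nil => simpa using hs
  | cons e l ih =>
    rw [← List.singleton_append, ← List.append_assoc] at hl ⊢
    refine ih (B ++ [e]) _ ?_ hl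
    beta_reduce
    have hBe : ∀ f ∈ B, H.weight f ≤ H.weight e := fun f hf =>
      (List.pairwise_append.mp (List.pairwise_append.mp hl).1).2.2 f hf e (by simp)
    have hval := val_forEachPair H e (push e) s
    obtain ⟨i1, i2, i3, i4, i5⟩ := foldl_push_spec e _ (nodup_sort_product H e) s hs.pairs
    rw [← hval] at i1 i2 i3
    refine ⟨i1, fun f => by rw [i2]; exact hs.inC f, fun f => by rw [i3]; exact hs.inS f,
      fun u v f => ?_, fun p f => ?_, fun p => ?_⟩
    · rw [hval, i5, mem_sort_product, hs.inE_iff, mem_product, List.mem_append,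
        List.mem_singleton]
      constructor
      · rintro (⟨rfl, h⟩ | ⟨h1, h2⟩)
        · exact ⟨Or.inr rfl, h⟩
        · exact ⟨Or.inl h1, h2⟩
      · rintro ⟨h1 | rfl, h2⟩
        · exact Or.inr ⟨h1, h2⟩
        · exact Or.inl ⟨rfl, h2⟩
    · rw [hval, i4]
      have h := hs.mem_queue p f
      split_ifs with hp <;> rw [mem_sort_product, mem_product] at hp
      · rw [List.mem_cons, h, List.mem_append, List.mem_singleton]
        constructor
        · rintro (rfl | ⟨h1, h2⟩)
          · exact ⟨Or.inr rfl, hp⟩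
          · exact ⟨Or.inl h1, h2⟩
        · rintro ⟨h1 | rfl, h2⟩
          · exact Or.inr ⟨h1, h2⟩
          · exact Or.inl rfl
      · rw [h, List.mem_append, List.mem_singleton]
        constructor
        · rintro ⟨h1, h2⟩
          exact ⟨Or.inl h1, h2⟩
        · rintro ⟨h1 | rfl, h2⟩
          · exact ⟨h1, h2⟩
          · exact absurd h2 hp
    · rw [hval, i4]
      split_ifs with hp
      · exact List.pairwise_cons.mpr ⟨fun f hf => hBe f ((hs.mem_queue p f).mp hf).1, hs.sorted p⟩
      · exact hs.sorted p

theorem builtUpTo_build (H : DirHypergraph V E) :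
    ∃ B : List E, (∀ e, e ∈ B ↔ e ∈ H.edges) ∧ BuiltUpTo H B (build H).val := by
  set l := (Timed.mergeSort (fun e f => decide (H.weight e ≤ H.weight f)) #H.edges
    (H.edges.sort (· ≤ ·))).val with hl
  refine ⟨l, fun e => by rw [hl, (mergeSort_perm _ _ _).mem_iff]; simp, ?_⟩
  have hblank : BuiltUpTo H [] (CoresetDS.blank : CoresetDS V E) :=
    ⟨⟨by simp [blank], by simp [blank]⟩, fun _ => rfl, fun _ => rfl, by simp [blank],
      by simp [blank], by simp [blank]⟩
  have hval : (build H).val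
      = l.foldl (fun s e => (forEachPair H e (push e) s).val) CoresetDS.blank := by
    simp only [build, val_bind, val_forEach, hl]
  rw [hval]
  have := builtUpTo_forEach_push H l [] _ hblank
    (by simpa using mergeSort_pairwise H.weight _ _ (by simp))
  simpa using this

/-! ### The initial state -/

omit [LinearOrder V] in
theorem foldl_toss_spec (ω : E → Bool) (l : List E) (s : CoresetDS V E) :
    ∃ T : E → Bool, l.foldl (fun s e => (toss ω e s).val) s = { s with inS := T } ∧
      ∀ e, T e = if e ∈ l ∧ s.inC e = false then ω e else s.inS e := by
  induction l generalizing s with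
  | nil => exact ⟨s.inS, rfl, by simp⟩
  | cons a l ih =>
    rw [List.foldl_cons]
    cases h : s.inC a with
    | true =>
      have hval : (toss ω a s).val = s := by simp [toss, h]
      obtain ⟨T, hT, hT2⟩ := ih s
      refine ⟨T, by rw [hval, hT], fun e => ?_⟩
      rw [hT2]
      by_cases hea : e = a
      · subst hea; simp [h]
      · simp [hea]
    | false =>
      have hval : (toss ω a s).val = { s with inS := Function.update s.inS a (ω a) } := by
        simp [toss, h]
      obtain ⟨T, hT, hT2⟩ := ih { s with inS := Function.update s.inS a (ω a) }
      refine ⟨T, by rw [hval, hT], fun e => ?_⟩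
      rw [hT2]
      by_cases hea : e = a
      · subst hea; simp [h]
      · simp [hea]

/-- The properties that are maintained by the data structure. -/
structure Valid [Fintype E] (lam : ℕ) (H : DirHypergraph V E) (ω : E → Bool) (A : Finset E)
    (s : CoresetDS V E) : Prop where
  consistent : Consistent H A s
  sample : SampleCorrect ω A s
  full : ∀ p, Full lam s p

theorem valid_initialState [Fintype E] (lam : ℕ) (H : DirHypergraph V E) (ω : E → Bool) :
    Valid lam H ω H.edges (initialState lam H ω).val := by
  obtain ⟨B, hB, hb⟩ := builtUpTo_build H
  set s₀ := (build H).val with hs₀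
  have hpart : ∀ p, s₀.part p = ∅ := fun p => by
    ext e; simp [mem_part, hb.inC e]
  have hcons : Consistent H H.edges s₀ :=
    ⟨fun u v e => by rw [hb.inE_iff, hB], hb.sorted,
      fun p e he => (hb.mem_queue p e).mpr ((hb.inE_iff _ _ _).mp he.1),
      fun e he => by simp [hb.inC e] at he, fun p e f hf => by simp [hb.inC f] at hf⟩
  have hfull : ∀ p ∉ s₀.pairs, Full lam s₀ p := fun p hp => by
    refine ⟨by simp [hpart p], fun e he => ?_⟩
    have h := hcons.mem_queue p e he
    have hq : s₀.queue p = [] := by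
      by_contra hne
      exact hp ((hb.pairs.2 p).mpr hne)
    simp [hq] at h
  obtain ⟨i1, i2, i3⟩ := foldl_addHeaviestMany_spec lam s₀.pairs hb.pairs.1 hcons hb.inS
    (fun p _ => hpart p) hfull
  set s₁ := s₀.pairs.foldl (fun s p => (addHeaviestMany lam p.1 p.2 s).val) s₀
  obtain ⟨T, hT, hT2⟩ := foldl_toss_spec ω (H.edges.sort (· ≤ ·)) s₁
  have hval : (initialState lam H ω).val = { s₁ with inS := T } := by
    simp only [initialState, val_bind, val_forEach]
    exact hT
  rw [hval]
  refine ⟨⟨i1.inE_iff, i1.sorted, i1.mem_queue, i1.source, i1.heaviest⟩, fun e => ?_, i3⟩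
  simp only [hT2, mem_sort, i2]
  split_ifs with h
  · simp [h.1, h.2]
  · simp only [false_iff]
    tauto

/-! ### Deletions -/

/-- The state in which `e` is removed from all tables. -/
def cleared (H : DirHypergraph V E) (e : E) (s : CoresetDS V E) : CoresetDS V E :=
  { s with
    inC := Function.update s.inC e false
    inE := fun x => if x.2.2 = e ∧ (x.1, x.2.1) ∈ H.tail e ×ˢ H.head e then false else s.inE x
    inS := Function.update s.inS e false }

theorem foldl_write_inE (e : E) (l : List (V × V)) (s : CoresetDS V E) :
    l.foldl (fun s p => { s with inE := Function.update s.inE (p.1, p.2, e) false }) s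
      = { s with inE := fun x => if x.2.2 = e ∧ (x.1, x.2.1) ∈ l then false else s.inE x } := by
  induction l generalizing s with
  | nil => simp
  | cons a l ih =>
    rw [List.foldl_cons, ih]
    congr 1
    funext ⟨u, v, f⟩
    by_cases hp : (u, v, f) = (a.1, a.2, e)
    · obtain ⟨rfl, rfl, rfl⟩ : u = a.1 ∧ v = a.2 ∧ f = e := by simpa using hp
      simp
    · have : ¬ (f = e ∧ (u, v) = a) := fun h => hp (by rw [h.1, ← h.2])
      simp only [Function.update_of_ne hp, List.mem_cons]
      congr 1
      simp only [eq_iff_iff]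
      tauto

theorem val_delete_of_inC_eq_false (H : DirHypergraph V E) (e : E) (s : CoresetDS V E)
    (he : s.inC e = false) : (delete H e s).val = cleared H e s := by
  have hr : (replace e s).val = s := by simp [replace, he]
  have hupd : Function.update s.inC e false = s.inC := by rw [← he, Function.update_eq_self]
  simp only [delete, val_bind, val_write, val_step, val_forEachPair, hr, foldl_write_inE, cleared,
    mem_sort_product, hupd]

theorem val_delete_of_inC_eq_true (H : DirHypergraph V E) (e : E) (s : CoresetDS V E)
    (he : s.inC e = true) {p : V × V} (hp : s.source e = some p) :
    (delete H e s).val = cleared H e (addHeaviest p.1 p.2 s).val.1 := by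
  have hr : (replace e s).val = { (addHeaviest p.1 p.2 s).val.1 with
      inC := Function.update (addHeaviest p.1 p.2 s).val.1.inC e false } := by
    simp [replace, he, hp]
  simp only [delete, val_bind, val_write, val_step, val_forEachPair, hr, foldl_write_inE, cleared,
    mem_sort_product]

theorem avail_of_avail_cleared {e f : E} {p : V × V} (hs : Consistent H A s)
    (h : (cleared H e s).Avail p f) : f ≠ e ∧ s.Avail p f := by
  have hE := h.1
  have hC := h.2
  simp only [cleared] at hE hC
  have hne : f ≠ e := by
    rintro rfl
    split_ifs at hE with h1
    refine h1 ⟨rfl, mem_product.mpr ((hs.inE_iff _ _ _).mp hE).2⟩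
  simp only [hne, false_and, if_false, Function.update_of_ne hne] at hE hC
  exact ⟨hne, hE, hC⟩

theorem Consistent.cleared (hs : Consistent H A s) (e : E) :
    Consistent H (A.erase e) (cleared H e s) := by
  refine ⟨fun u v f => ?_, hs.sorted, fun p f hf => hs.mem_queue p f (avail_of_avail_cleared hs hf).2,
    fun f hf => ?_, fun p g f hf hfp hg => ?_⟩
  · by_cases hfe : f = e
    · subst hfe
      have := hs.inE_iff u v f
      simp only [DecrementalCoresetAndSample.cleared, true_and, mem_product, mem_erase, ne_eq, not_true_eq_false,
        false_and, iff_false]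
      split_ifs with h
      · simp
      · rw [this]; tauto
    · simp only [DecrementalCoresetAndSample.cleared, hfe, false_and, if_false, mem_erase, ne_eq, not_false_eq_true,
        true_and]
      exact hs.inE_iff u v f
  · have hfe : f ≠ e := by
      rintro rfl
      simp [DecrementalCoresetAndSample.cleared] at hf
    simp only [DecrementalCoresetAndSample.cleared, Function.update_of_ne hfe] at hf
    simpa [DecrementalCoresetAndSample.cleared, hfe] using hs.source f hf
  · have hfe : f ≠ e := by
      rintro rfl
      simp [DecrementalCoresetAndSample.cleared] at hf
    simp only [DecrementalCoresetAndSample.cleared, Function.update_of_ne hfe] at hf hfp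
    exact hs.heaviest p g f hf hfp (avail_of_avail_cleared hs hg).2

theorem SampleCorrect.cleared {ω : E → Bool} (hs : SampleCorrect ω A s) (e : E) :
    SampleCorrect ω (A.erase e) (cleared H e s) := by
  intro f
  by_cases hfe : f = e
  · subst hfe; simp [DecrementalCoresetAndSample.cleared]
  · simpa [DecrementalCoresetAndSample.cleared, hfe] using hs f

theorem part_cleared [Fintype E] (e : E) (p : V × V) :
    (cleared H e s).part p = (s.part p).erase e := by
  ext f
  by_cases hfe : f = e
  · subst hfe; simp [mem_part, cleared]
  · simp [mem_part, cleared, hfe]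

/-- The replacement is chosen while `e` is still in the coreset, so `e` cannot replace itself; the
part of its source pair gains one member and loses one. If there is no replacement, nothing is
available for that pair and fullness demands only the upper bound. The stale entry `source e` is
harmless, as parts also require membership in the coreset. -/
theorem Valid.delete [Fintype E] {lam : ℕ} {ω : E → Bool} (hs : Valid lam H ω A s) (e : E) :
    Valid lam H ω (A.erase e) (delete H e s).val := by
  have hcons := hs.consistent
  cases he : s.inC e with
  | false =>
    rw [val_delete_of_inC_eq_false H e s he]
    refine ⟨hcons.cleared e, hs.sample.cleared e, fun p => ?_⟩
    have hpart : (cleared H e s).part p = s.part p := by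
      rw [part_cleared, erase_eq_of_notMem]
      simp [mem_part, he]
    rw [Full, hpart]
    exact ⟨(hs.full p).1, fun f hf => (hs.full p).2 f (avail_of_avail_cleared hcons hf).2⟩
  | true =>
    obtain ⟨⟨u, v⟩, hp, -⟩ := hcons.source e he
    rw [val_delete_of_inC_eq_true H e s he hp]
    have hcons' := hcons.addHeaviest u v
    refine ⟨hcons'.cleared e, (hs.sample.addHeaviest u v).cleared e, fun q => ?_⟩
    have havail : ∀ f, (cleared H e (addHeaviest u v s).val.1).Avail q f → s.Avail q f :=
      fun f hf => avail_of_avail_addHeaviest (avail_of_avail_cleared hcons' hf).2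
    have hmem : e ∈ s.part (u, v) := mem_part.mpr ⟨he, hp⟩
    rw [Full, part_cleared]
    by_cases hq : q = (u, v)
    · subst hq
      rcases part_addHeaviest hcons u v with ⟨-, h2, h3⟩ | ⟨-, f, h2, h3, -⟩
      · rw [h2]
        exact ⟨card_erase_le.trans (hs.full (u, v)).1,
          fun f hf => absurd (avail_of_avail_cleared hcons' hf).2 (h3 f)⟩
      · have hcard : #(((addHeaviest u v s).val.1.part (u, v)).erase e) = #(s.part (u, v)) := by
          rw [h3, card_erase_of_mem (mem_insert_of_mem hmem), card_insert_of_notMem]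
          · simp
          · simp [mem_part, h2]
        rw [hcard]
        exact ⟨(hs.full (u, v)).1, fun f hf => (hs.full (u, v)).2 f (havail f hf)⟩
    · have hpart : (addHeaviest u v s).val.1.part q = s.part q := by
        rcases part_addHeaviest hcons u v with ⟨-, h2, -⟩ | ⟨-, f, -, -, h4⟩
        · exact h2 q
        · exact h4 q hq
      have hne : e ∉ s.part q := fun h => hq (by
        have := (mem_part.mp h).2
        rw [hp] at this
        exact (Option.some.inj this).symm)
      rw [hpart, erase_eq_of_notMem hne]
      exact ⟨(hs.full q).1, fun f hf => (hs.full q).2 f (havail f hf)⟩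

theorem Valid.foldl_delete [Fintype E] {lam : ℕ} {ω : E → Bool} (hs : Valid lam H ω A s)
    (l : List E) :
    Valid lam H ω (A \ l.toFinset) (l.foldl (fun s e => (DecrementalCoresetAndSample.delete H e s).val) s) := by
  induction l generalizing A s with
  | nil => simpa using hs
  | cons e l ih =>
    have := ih (hs.delete e)
    rwa [show A.erase e \ l.toFinset = A \ (e :: l).toFinset by
      ext f; simp only [mem_sdiff, mem_erase, List.mem_toFinset, List.mem_cons]; tauto] at this

theorem val_run (lam : ℕ) (H : DirHypergraph V E) (ω : E → Bool) (l : List E) :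
    (run lam H ω l).val
      = l.foldl (fun s e => (delete H e s).val) (initialState lam H ω).val := by
  simp only [run, val_bind, val_forEach]

theorem valid_run [Fintype E] (lam : ℕ) (H : DirHypergraph V E) (ω : E → Bool) (l : List E) :
    Valid lam H ω (H.deleteAll l).edges (run lam H ω l).val := by
  rw [val_run]
  exact (valid_initialState lam H ω).foldl_delete l

theorem Valid.isCoreset [Fintype E] {lam : ℕ} {ω : E → Bool} {l : List E}
    (hs : Valid lam H ω (H.deleteAll l).edges s) : (H.deleteAll l).IsCoreset lam s.coreset := by
  have hcons := hs.consistent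
  have hpair : ∀ p e, s.inE (p.1, p.2, e) = true ↔ e ∈ (H.deleteAll l).pairEdges p := by
    intro p e
    rw [hcons.inE_iff]
    rw [DirHypergraph.mem_pairEdges, mem_product]
    rfl
  have hC : ∀ e, e ∈ s.coreset ↔ s.inC e = true := fun e => by simp [coreset]
  refine ⟨s.part, fun p q hpq => ?_, fun e => ?_, fun p => ⟨fun e he => ?_, (hs.full p).1⟩,
    fun p e he heC => ?_⟩
  · rw [disjoint_left]
    intro e hp hq
    have h := (mem_part.mp hp).2
    rw [(mem_part.mp hq).2] at h
    exact hpq (Option.some.inj h).symm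
  · rw [hC]
    constructor
    · intro he
      obtain ⟨p, hp, -⟩ := hcons.source e he
      exact ⟨p, mem_part.mpr ⟨he, hp⟩⟩
    · rintro ⟨p, hp⟩
      exact (mem_part.mp hp).1
  · obtain ⟨h1, h2⟩ := mem_part.mp he
    obtain ⟨q, hq, hqE⟩ := hcons.source e h1
    rw [h2] at hq
    obtain rfl := Option.some.inj hq
    exact (hpair _ _).mp hqE
  · have hav : s.Avail p e := ⟨(hpair p e).mpr he, by rw [hC] at heC; simpa using heC⟩
    exact ⟨(hs.full p).2 e hav, fun f hf =>
      hcons.heaviest p e f (mem_part.mp hf).1 (mem_part.mp hf).2 hav⟩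

theorem Valid.sample_eq [Fintype E] {lam : ℕ} {ω : E → Bool} (hs : Valid lam H ω A s) :
    s.sample = (A \ s.coreset).filter fun e => ω e = true := by
  ext e
  simp only [CoresetDS.sample, mem_filter, mem_univ, true_and, mem_sdiff, coreset]
  rw [hs.sample e]
  simp only [Bool.not_eq_true, and_assoc]

end DecrementalCoresetAndSample

/-! ### Running times -/

namespace Timed

universe u v

/-- Potential method: `b` is the amortized cost of the body; one more step per round and one for the
final empty list belong to the loop. -/
theorem time_forEach_add_le {α : Type v} {σ : Type u} (f : α → σ → Timed σ) (Φ : σ → ℕ) (b : ℕ)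
    (l : List α) (h : ∀ a ∈ l, ∀ s, (f a s).time + Φ (f a s).val ≤ Φ s + b) (s : σ) :
    (forEach f l s).time + Φ (forEach f l s).val ≤ Φ s + (b + 1) * l.length + 1 := by
  induction l generalizing s with
  | nil => simp [forEach]; omega
  | cons a l ih =>
    have h1 := h a (by simp) s
    have h2 := ih (fun a' ha' => h a' (by simp [ha'])) (f a s).val
    simp only [forEach, time_bind, val_bind, time_step, val_step, List.length_cons]
    rw [mul_add]
    omega

theorem time_split_le {α : Type u} (l : List α) : (split l).time ≤ l.length / 2 + 1 := by
  induction l using split.induct with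
  | case1 => simp [split]
  | case2 a => simp [split]
  | case3 a b l ih =>
    simp only [split, time_bind, time_step, List.length_cons]
    omega

theorem time_merge_le {α : Type u} (le : α → α → Bool) (l l' : List α) :
    (merge le l l').time ≤ l.length + l'.length + 1 := by
  induction l, l' using merge.induct le with
  | case1 l => simp [merge]
  | case2 a l => simp [merge]
  | case3 a l b l' h ih =>
    rw [merge, if_pos h]
    simp only [time_bind, time_step, List.length_cons] at ih ⊢
    omega
  | case4 a l b l' h ih =>
    rw [merge, if_neg h]
    simp only [time_bind, time_step, List.length_cons] at ih ⊢
    omega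

theorem time_mergeSort_le {α : Type u} (le : α → α → Bool) (k : ℕ) (l : List α)
    (hl : 1 ≤ l.length) :
    (mergeSort le k l).time ≤ 4 * l.length * Nat.clog 2 l.length + l.length := by
  induction k generalizing l with
  | zero => simp only [mergeSort, time_step]; omega
  | succ k ih =>
    match l with
    | [] => simp at hl
    | [a] => simp [mergeSort]
    | a :: b :: l =>
      have hs := length_split (a :: b :: l)
      have hsp := time_split_le (a :: b :: l)
      set p := (split (a :: b :: l)).val with hp
      have h1 := ih p.1 (by rw [hs.1]; simp only [List.length_cons]; omega)
      have h2 := ih p.2 (by rw [hs.2]; simp only [List.length_cons]; omega)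
      have h3 := time_merge_le le (mergeSort le k p.1).val (mergeSort le k p.2).val
      rw [(mergeSort_perm le k p.1).length_eq, (mergeSort_perm le k p.2).length_eq] at h3
      simp only [mergeSort, time_bind, ← hp]
      set n := (a :: b :: l).length with hn
      have hn2 : 2 ≤ n := by rw [hn]; simp
      -- The larger half has one level of recursion less, and splitting and merging on one level
      -- cost at most `4 n`.
      have hclog : Nat.clog 2 n = Nat.clog 2 ((n + 1) / 2) + 1 := by
        rw [Nat.clog_of_two_le (by norm_num) hn2]
        rfl
      have hmono : Nat.clog 2 p.2.length ≤ Nat.clog 2 ((n + 1) / 2) :=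
        Nat.clog_mono_right 2 (by rw [hs.2]; omega)
      rw [hs.1] at h1
      have hsum : p.1.length + p.2.length = n := by rw [hs.1, hs.2]; omega
      have h2' : 4 * p.2.length * Nat.clog 2 p.2.length
          ≤ 4 * p.2.length * Nat.clog 2 ((n + 1) / 2) := Nat.mul_le_mul_left _ hmono
      have hprod : 4 * ((n + 1) / 2) * Nat.clog 2 ((n + 1) / 2)
          + 4 * p.2.length * Nat.clog 2 ((n + 1) / 2) = 4 * n * Nat.clog 2 ((n + 1) / 2) := by
        rw [← add_mul, ← mul_add, ← hs.1, hsum]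
      rw [hclog, mul_add, mul_one]
      omega

end Timed

namespace CoresetDS

variable {V E : Type*}

/-- The total length of all queues. -/
def totalLength [Fintype V] (s : CoresetDS V E) : ℕ := ∑ p, (s.queue p).length

theorem sum_length_update [Fintype V] [DecidableEq V] (q : V × V → List E) (a : V × V)
    (l : List E) :
    ∑ p, (Function.update q a l p).length + (q a).length = ∑ p, (q p).length + l.length := by
  rw [← add_sum_erase univ _ (mem_univ a), ← add_sum_erase univ (fun p => (q p).length) (mem_univ a),
    sum_congr rfl fun p hp => by rw [Function.update_of_ne (ne_of_mem_erase hp)]]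
  simp only [Function.update_self]
  omega

end CoresetDS

namespace DecrementalCoresetAndSample

open Timed CoresetDS

variable {V E : Type} [LinearOrder V] [LinearOrder E] [Fintype V]

-- Every scanned entry costs three steps and leaves the queue.
omit [LinearOrder V] [LinearOrder E] [Fintype V] in
theorem time_scan_add_le (s : CoresetDS V E) (u v : V) (q : List E) :
    (scan s u v q).time + 3 * (scan s u v q).val.2.length ≤ 3 * q.length + 1 := by
  induction q with
  | nil => simp [scan]
  | cons e q ih =>
    cases h : s.inE (u, v, e) && !s.inC e
    · simp only [scan, time_bind, val_bind, val_read, time_read, List.length_cons, h,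
        Bool.false_eq_true, if_false, time_step, val_step]
      omega
    · simp only [scan, time_bind, val_bind, val_read, time_read, List.length_cons, h,
        if_true, time_step, val_step]
      omega

theorem time_addHeaviest_add_le (u v : V) (s : CoresetDS V E) :
    (addHeaviest u v s).time + 3 * (addHeaviest u v s).val.1.totalLength
      ≤ 3 * s.totalLength + 7 := by
  have h1 := time_scan_add_le s u v (s.queue (u, v))
  have hq : (addHeaviest u v s).val.1.queue
      = Function.update s.queue (u, v) (scan s u v (s.queue (u, v))).val.2 := by
    simp only [addHeaviest, val_bind, val_read, val_write]
    split <;> rfl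
  have h2 := sum_length_update s.queue (u, v) (scan s u v (s.queue (u, v))).val.2
  rw [← hq] at h2
  have ht : (addHeaviest u v s).time ≤ (scan s u v (s.queue (u, v))).time + 6 := by
    simp only [addHeaviest, time_bind, val_read, val_write, time_read, time_write]
    split <;> simp <;> omega
  simp only [totalLength]
  omega

theorem totalLength_addHeaviest (u v : V) (s : CoresetDS V E) :
    (addHeaviest u v s).val.1.totalLength ≤ s.totalLength ∧
    ((addHeaviest u v s).val.2 = true →
      (addHeaviest u v s).val.1.totalLength + 1 ≤ s.totalLength) := by
  rcases addHeaviest_cases u v s with ⟨h1, -⟩ | ⟨q₀, e, q₁, h1, h2, -, -⟩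
  · have := sum_length_update s.queue (u, v) []
    rw [h1]
    simp only [totalLength, List.length_nil, Bool.false_eq_true, false_implies, and_true] at this ⊢
    omega
  · have := sum_length_update s.queue (u, v) q₁
    rw [h2]
    rw [h1] at this
    simp only [totalLength, List.length_append, List.length_cons, true_implies] at this ⊢
    omega

/-- The bound is free of `k`. A successful call removes a queue entry, whose 10 units pay 3 for
scanning and 7 for the call overhead; only the final step or the single failing call (7 + 1)
remains. -/
theorem time_addHeaviestMany_add_le (k : ℕ) (u v : V) (s : CoresetDS V E) :
    (addHeaviestMany k u v s).time + 10 * (addHeaviestMany k u v s).val.totalLength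
      ≤ 10 * s.totalLength + 8 := by
  induction k generalizing s with
  | zero => simp only [addHeaviestMany, time_step, val_step]; omega
  | succ k ih =>
    have h1 := time_addHeaviest_add_le u v s
    have h2 := totalLength_addHeaviest u v s
    have h3 := ih (addHeaviest u v s).val.1
    simp only [addHeaviestMany, time_bind, val_bind]
    split_ifs with h
    · have := h2.2 h
      omega
    · simp only [time_step, val_step]
      omega

omit [LinearOrder E] [Fintype V] in
theorem time_forEachPair_add_le (H : DirHypergraph V E) {e : E} (he : e ∈ H.edges)
    (f : V → V → CoresetDS V E → Timed (CoresetDS V E)) (Φ : CoresetDS V E → ℕ) (b : ℕ)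
    (h : ∀ u v s, (f u v s).time + Φ (f u v s).val ≤ Φ s + b) (s : CoresetDS V E) :
    (forEachPair H e f s).time + Φ (forEachPair H e f s).val ≤ Φ s + (b + 4) * H.rank ^ 2 := by
  have hr : #(H.tail e ∪ H.head e) ≤ H.rank :=
    le_sup (f := fun e => #(H.tail e ∪ H.head e)) he
  have ht : #(H.tail e) ≤ H.rank := (card_le_card subset_union_left).trans hr
  have hh : #(H.head e) ≤ H.rank := (card_le_card subset_union_right).trans hr
  have h1 : 1 ≤ H.rank := (H.tail_nonempty e).card_pos.trans_le ht
  have hin : ∀ u s, (forEach (fun v s => f u v s) ((H.head e).sort (· ≤ ·)) s).time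
      + Φ (forEach (fun v s => f u v s) ((H.head e).sort (· ≤ ·)) s).val
      ≤ Φ s + ((b + 1) * #(H.head e) + 1) := fun u s => by
    have := time_forEach_add_le (fun v s => f u v s) Φ b ((H.head e).sort (· ≤ ·))
      (fun v _ s => h u v s) s
    rw [length_sort] at this
    omega
  have hout := time_forEach_add_le
    (fun u s => forEach (fun v s => f u v s) ((H.head e).sort (· ≤ ·)) s) Φ _
    ((H.tail e).sort (· ≤ ·)) (fun u _ s => hin u s) s
  rw [length_sort] at hout
  refine hout.trans ?_
  have : ((b + 1) * #(H.head e) + 1 + 1) * #(H.tail e)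
      ≤ ((b + 1) * H.rank + 1 + 1) * H.rank := by gcongr
  nlinarith

/-- Four steps, plus 10 units for the new queue entry and 10 for a possibly new pair. The latter pay
for the round, of amortized cost 9, in which the coreset is filled from that pair. -/
theorem time_push_add_le (e : E) (u v : V) (s : CoresetDS V E) :
    (push e u v s).time + (10 * (push e u v s).val.totalLength
      + 10 * (push e u v s).val.pairs.length)
      ≤ 10 * s.totalLength + 10 * s.pairs.length + 24 := by
  have h := sum_length_update s.queue (u, v) (e :: s.queue (u, v))
  have ht : (push e u v s).time = 4 := by
    simp only [push, time_bind, val_read, val_write, time_read, time_write]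
    cases s.queue (u, v) <;> simp
  rw [ht, val_push]
  simp only [totalLength, List.length_cons] at h ⊢
  split <;> (try simp only [List.length_cons]) <;> omega

theorem time_build_add_le (H : DirHypergraph V E) (hm : 1 ≤ #H.edges) :
    (build H).time + (10 * (build H).val.totalLength + 10 * (build H).val.pairs.length)
      ≤ 4 * #H.edges * Nat.clog 2 #H.edges + #H.edges + (28 * H.rank ^ 2 + 1) * #H.edges + 1 := by
  have h1 := time_mergeSort_le (fun e f => decide (H.weight e ≤ H.weight f)) #H.edges
    (H.edges.sort (· ≤ ·)) (by rwa [length_sort])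
  rw [length_sort] at h1
  have hperm := mergeSort_perm (fun e f => decide (H.weight e ≤ H.weight f)) #H.edges
    (H.edges.sort (· ≤ ·))
  have h2 := time_forEach_add_le (fun e s => forEachPair H e (push e) s)
    (fun s => 10 * s.totalLength + 10 * s.pairs.length) (28 * H.rank ^ 2)
    (Timed.mergeSort (fun e f => decide (H.weight e ≤ H.weight f)) #H.edges
      (H.edges.sort (· ≤ ·))).val
    (fun e he s => time_forEachPair_add_le H (by simpa using hperm.mem_iff.mp he) (push e)
      (fun s => 10 * s.totalLength + 10 * s.pairs.length) 24
      (fun u v s => time_push_add_le e u v s) s) CoresetDS.blank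
  rw [hperm.length_eq, length_sort] at h2
  have h0 : 10 * (CoresetDS.blank : CoresetDS V E).totalLength
      + 10 * (CoresetDS.blank : CoresetDS V E).pairs.length = 0 := by
    simp [CoresetDS.blank, totalLength]
  simp only [h0] at h2
  simp only [build, time_bind, val_bind]
  omega

omit [LinearOrder V] in
theorem time_toss_add_le (ω : E → Bool) (e : E) (s : CoresetDS V E) :
    (toss ω e s).time + 10 * (toss ω e s).val.totalLength ≤ 10 * s.totalLength + 4 := by
  cases h : s.inC e <;> simp [toss, h, totalLength] <;> omega

theorem time_initialState_add_le (lam : ℕ) (H : DirHypergraph V E) (ω : E → Bool)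
    (hm : 1 ≤ #H.edges) :
    (initialState lam H ω).time + 10 * (initialState lam H ω).val.totalLength
      ≤ 4 * #H.edges * Nat.clog 2 #H.edges + (28 * H.rank ^ 2 + 7) * #H.edges + 3 := by
  simp only [initialState, time_bind, val_bind]
  have h1 := time_build_add_le H hm
  set s := (build H).val
  have h2 := time_forEach_add_le (fun p s => addHeaviestMany lam p.1 p.2 s)
    (fun s => 10 * s.totalLength) 8 s.pairs
    (fun p _ s => time_addHeaviestMany_add_le lam p.1 p.2 s) s
  set s' := (forEach (fun (p : V × V) s => addHeaviestMany lam p.1 p.2 s) s.pairs s).val with hs'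
  have h3 := time_forEach_add_le (toss ω) (fun s => 10 * s.totalLength) 4
    (H.edges.sort (· ≤ ·)) (fun e _ s => time_toss_add_le ω e s) s'
  rw [length_sort] at h3
  have hring : (28 * H.rank ^ 2 + 7) * #H.edges
      = (28 * H.rank ^ 2 + 1) * #H.edges + 6 * #H.edges := by ring
  rw [hring]
  omega

theorem time_replace_add_le (e : E) (s : CoresetDS V E) :
    (replace e s).time + 10 * (replace e s).val.totalLength ≤ 10 * s.totalLength + 11 := by
  cases h : s.inC e with
  | false => simp [replace, h]; omega
  | true =>
    cases hp : s.source e with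
    | none => simp [replace, h, hp]; omega
    | some p =>
      have h1 := time_addHeaviest_add_le p.1 p.2 s
      have h2 := (totalLength_addHeaviest p.1 p.2 s).1
      simp only [totalLength] at h1 h2 ⊢
      simp [replace, h, hp]
      omega

theorem time_delete_add_le (H : DirHypergraph V E) {e : E} (he : e ∈ H.edges)
    (s : CoresetDS V E) :
    (delete H e s).time + 10 * (delete H e s).val.totalLength
      ≤ 10 * s.totalLength + (6 * H.rank ^ 2 + 13) := by
  have h1 := time_replace_add_le e s
  have h2 := time_forEachPair_add_le H he (fun u v s => do
      let inE ← write s.inE (u, v, e) false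
      step { s with inE := inE }) (fun s => 10 * s.totalLength) 2
    (fun u v s => by
      simp only [time_bind, val_bind, time_step, val_step, time_write, totalLength]; omega)
    (replace e s).val
  simp only [delete, time_bind, val_bind, time_step, val_step, time_write, val_write]
  simp only [totalLength] at h1 h2 ⊢
  omega

theorem time_run_le (lam : ℕ) (H : DirHypergraph V E) (ω : E → Bool) (l : List E)
    (hm : 2 ≤ #H.edges) (hl : l.Nodup) (hlH : ∀ e ∈ l, e ∈ H.edges) :
    (run lam H ω l).time
      ≤ 4 * #H.edges * Nat.clog 2 #H.edges + 57 * H.rank ^ 2 * #H.edges := by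
  have h1 := time_initialState_add_le lam H ω (by omega)
  have h2 := time_forEach_add_le (delete H) (fun s => 10 * s.totalLength) _ l
    (fun e he s => time_delete_add_le H (hlH e he) s) (initialState lam H ω).val
  have hlen : l.length ≤ #H.edges := by
    rw [← List.toFinset_card_of_nodup hl]
    exact card_le_card fun e he => hlH e (List.mem_toFinset.mp he)
  have hr : 1 ≤ H.rank ^ 2 := by
    obtain ⟨e, he⟩ := card_pos.mp (show 0 < #H.edges by omega)
    have h3 : #(H.tail e ∪ H.head e) ≤ H.rank :=
      le_sup (f := fun e => #(H.tail e ∪ H.head e)) he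
    have h4 := (card_le_card (subset_union_left (s₂ := H.head e))).trans h3
    exact Nat.one_le_pow _ _ ((H.tail_nonempty e).card_pos.trans_le h4)
  have h5 : (6 * H.rank ^ 2 + 13 + 1) * l.length ≤ (6 * H.rank ^ 2 + 13 + 1) * #H.edges :=
    Nat.mul_le_mul_left _ hlen
  have h6 : #H.edges ≤ H.rank ^ 2 * #H.edges := Nat.le_mul_of_pos_left _ hr
  simp only [run, time_bind]
  -- The constant is `57 = (28 + 6) + (7 + 14) + 2`, the last 2 absorbing the additive 4 because `m
  -- ≥ 2`.
  nlinarith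

/-! ### The coreset does not depend on the coins -/

/-- The states agree except possibly for the sample. -/
def SameUpToSample {V E : Type*} (s s' : CoresetDS V E) : Prop :=
  ∃ T : E → Bool, s' = { s with inS := T }

omit [LinearOrder V] [LinearOrder E] [Fintype V] in
theorem scan_eq_of_inS (s : CoresetDS V E) (T : E → Bool) (u v : V) (q : List E) :
    scan { s with inS := T } u v q = scan s u v q := by
  induction q with
  | nil => rfl
  | cons e q ih => simp only [scan, ih]

omit [Fintype V] in
theorem SameUpToSample.addHeaviest {s s' : CoresetDS V E} (h : SameUpToSample s s') (u v : V) :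
    SameUpToSample (addHeaviest u v s).val.1 (addHeaviest u v s').val.1 := by
  obtain ⟨T, rfl⟩ := h
  simp only [DecrementalCoresetAndSample.addHeaviest, val_bind, val_read, val_write, scan_eq_of_inS]
  split
  · exact ⟨T, rfl⟩
  · rename_i e _
    exact ⟨Function.update T e false, rfl⟩

omit [Fintype V] in
theorem SameUpToSample.replace {s s' : CoresetDS V E} (h : SameUpToSample s s') (e : E) :
    SameUpToSample (replace e s).val (replace e s').val := by
  have hadd := h.addHeaviest
  obtain ⟨T, rfl⟩ := h
  cases hC : s.inC e with
  | false => exact ⟨T, by simp [DecrementalCoresetAndSample.replace, hC]⟩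
  | true =>
    cases hp : s.source e with
    | none => exact ⟨T, by simp [DecrementalCoresetAndSample.replace, hC, hp]⟩
    | some p =>
      obtain ⟨T', hT'⟩ := hadd p.1 p.2
      exact ⟨T', by simp [DecrementalCoresetAndSample.replace, hC, hp, hT']⟩

omit [Fintype V] in
theorem SameUpToSample.delete {s s' : CoresetDS V E} (h : SameUpToSample s s')
    (H : DirHypergraph V E) (e : E) : SameUpToSample (delete H e s).val (delete H e s').val := by
  obtain ⟨T, hT⟩ := h.replace e
  simp only [DecrementalCoresetAndSample.delete, val_bind, val_write, val_step, val_forEachPair,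
    foldl_write_inE, hT]
  exact ⟨_, rfl⟩

omit [Fintype V] in
theorem sameUpToSample_run (lam : ℕ) (H : DirHypergraph V E) (ω ω' : E → Bool) (l : List E) :
    SameUpToSample (run lam H ω l).val (run lam H ω' l).val := by
  have hfold : ∀ s s' : CoresetDS V E, SameUpToSample s s' →
      SameUpToSample (l.foldl (fun s e => (delete H e s).val) s)
        (l.foldl (fun s e => (delete H e s).val) s') := by
    induction l with
    | nil => exact fun _ _ h => h
    | cons e l ih => exact fun s s' h => ih _ _ (h.delete H e)
  rw [val_run, val_run]
  refine hfold _ _ ?_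
  simp only [initialState, val_bind, val_forEach]
  set s := (build H).val.pairs.foldl (fun s p => (addHeaviestMany lam p.1 p.2 s).val) (build H).val
  obtain ⟨T, hT, -⟩ := foldl_toss_spec ω (H.edges.sort (· ≤ ·)) s
  obtain ⟨T', hT', -⟩ := foldl_toss_spec ω' (H.edges.sort (· ≤ ·)) s
  rw [hT, hT']
  exact ⟨T', rfl⟩

-- The table `inS` is written but never read, and coins reach no other table. Hence the coins are
-- still independent fair coins relative to the coreset at any fixed time.
omit [Fintype V] in
theorem coreset_run_eq [Fintype E] (lam : ℕ) (H : DirHypergraph V E) (ω ω' : E → Bool)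
    (l : List E) : (run lam H ω l).val.coreset = (run lam H ω' l).val.coreset := by
  obtain ⟨T, hT⟩ := sameUpToSample_run lam H ω ω' l
  rw [hT]
  rfl

end DecrementalCoresetAndSample

/-! ### The main theorem -/

namespace DecrementalCoresetAndSample

open DirHypergraph

theorem natClog_le_four_mul_log {m : ℕ} (hm : 2 ≤ m) : (Nat.clog 2 m : ℝ) ≤ 4 * Real.log m := by
  have h1 : Nat.clog 2 m ≤ Nat.log 2 m + 1 :=
    Nat.clog_le_of_le_pow (Nat.lt_pow_succ_log_self (by norm_num) m).le
  have h2 : (Nat.clog 2 m : ℝ) ≤ Nat.log 2 m + 1 := by exact_mod_cast h1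
  linarith [natLog_le_two_mul_log hm, half_lt_log hm]

variable {V E : Type} [LinearOrder V] [LinearOrder E] [Fintype V]

theorem amortizedTime_run_le (lam : ℕ) (H : DirHypergraph V E) (ω : E → Bool) (l : List E)
    (hm : 2 ≤ #H.edges) (hl : l.Nodup) (hlH : ∀ e ∈ l, e ∈ H.edges) :
    ((run lam H ω l).time : ℝ) / #H.edges ≤ 130 * (H.rank ^ 2 * Real.log #H.edges) := by
  have h1 : ((run lam H ω l).time : ℝ)
      ≤ 4 * #H.edges * Nat.clog 2 #H.edges + 57 * H.rank ^ 2 * #H.edges := by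
    exact_mod_cast time_run_le lam H ω l hm hl hlH
  have h2 := natClog_le_four_mul_log hm
  have h3 := half_lt_log hm
  have hr : (1 : ℝ) ≤ H.rank ^ 2 := by
    obtain ⟨e, he⟩ := card_pos.mp (show 0 < #H.edges by omega)
    have h3 : #(H.tail e ∪ H.head e) ≤ H.rank :=
      le_sup (f := fun e => #(H.tail e ∪ H.head e)) he
    have h4 := (card_le_card (subset_union_left (s₂ := H.head e))).trans h3
    exact_mod_cast Nat.one_le_pow 2 _ ((H.tail_nonempty e).card_pos.trans_le h4)
  have hpos : (0 : ℝ) < #H.edges := by exact_mod_cast (show 0 < #H.edges by omega)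
  rw [div_le_iff₀ hpos]
  set L := Real.log #H.edges
  set M : ℝ := ((#H.edges : ℕ) : ℝ)
  set R : ℝ := (H.rank : ℝ) ^ 2
  calc _ ≤ _ := h1
    _ ≤ 4 * M * (4 * L) + 57 * R * M := by gcongr
    _ = (16 * L + 57 * R) * M := by ring
    _ ≤ (16 * (R * L) + 57 * (R * (2 * L))) * M := by
        gcongr
        · exact le_mul_of_one_le_left (by linarith) hr
        · exact le_mul_of_one_le_right (by linarith) (by linarith)
    _ = 130 * (R * L) * M := by ring

variable [Fintype E]

theorem measure_not_isSpectralHypersparsifier_run_le (H : DirHypergraph V E) {lam : ℕ} {ε c : ℝ}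
    (l : List E) (hlam : 0 < lam) (hm : 2 ≤ #H.edges) (hc : 0 ≤ c)
    (hε : 12 * Real.log #H.edges * ((√lam)⁻¹ * √(8 * (c + 8) * Real.log #H.edges)) ≤ ε) :
    (fairCoins E).real {ω | ¬ IsSpectralHypersparsifier ε
        (H.coresetUnionSample (run lam H ω l).val.coreset (run lam H ω l).val.sample)
        (H.deleteAll l)} ≤ Real.exp (-((c + 3) * Real.log #H.edges)) := by
  -- Any fixed outcome of the coins may be used to name the deterministic coreset.
  set C := (run lam H (fun _ => false) l).val.coreset with hC
  have hcore : (H.deleteAll l).IsCoreset lam C := (valid_run lam H _ l).isCoreset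
  have hset : ∀ ω, H.coresetUnionSample (run lam H ω l).val.coreset (run lam H ω l).val.sample
      = (H.deleteAll l).coresetUnionSample C
        (((H.deleteAll l).edges \ C).filter fun e => ω e = true) := fun ω => by
    rw [(valid_run lam H ω l).sample_eq, coreset_run_eq lam H ω (fun _ => false) l]
    rfl
  simp only [hset]
  exact measure_not_isSpectralHypersparsifier_le hcore hlam hm (card_le_card sdiff_subset) hc hε

/-- The successes are counted among all original hyperedges, so the bound does not depend on the
deletions and one tail event serves all times. -/
theorem card_coresetUnionSample_run_le (H : DirHypergraph V E) (lam : ℕ) (ω : E → Bool)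
    (l : List E) :
    #(H.coresetUnionSample (run lam H ω l).val.coreset (run lam H ω l).val.sample).edges
      ≤ Fintype.card V ^ 2 * lam + #(H.edges.filter fun e => ω e = true) := by
  have hv := valid_run lam H ω l
  refine (card_union_le _ _).trans (add_le_add hv.isCoreset.card_le (card_le_card ?_))
  rw [hv.sample_eq]
  exact filter_subset_filter _ (sdiff_subset.trans sdiff_subset)

/-! ### Choice of the constants -/

theorem coresetSize_error_le {c ε l : ℝ} (hc : 0 ≤ c) (hε : 0 < ε) (hl : 0 < l) {lam : ℕ}
    (hlam : 1152 * (c + 8) * l ^ 3 / ε ^ 2 ≤ lam) :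
    12 * l * ((√lam)⁻¹ * √(8 * (c + 8) * l)) ≤ ε := by
  have hpos : (0 : ℝ) < lam := lt_of_lt_of_le (by positivity) hlam
  rw [div_le_iff₀ (by positivity)] at hlam
  -- After squaring, the claim is the hypothesis on `lam`, as `1152 = 12² * 8`.
  refine le_of_sq_le_sq ?_ hε.le
  rw [mul_pow, mul_pow, mul_pow, inv_pow, Real.sq_sqrt hpos.le, Real.sq_sqrt (by positivity),
    ← div_eq_inv_mul, mul_div_assoc', div_le_iff₀ hpos]
  nlinarith

theorem coresetSize_le {κ ε l : ℝ} (hκ : 0 < κ) (hε : 0 < ε) (hε1 : ε < 1) (hl : 1 / 2 < l) :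
    (⌈κ * l ^ 3 / ε ^ 2⌉₊ : ℝ) ≤ (κ + 8) * l ^ 3 / ε ^ 2 := by
  have hl0 : 0 < l := by linarith
  -- The rounding error of the ceiling is absorbed, since `l > 1/2` and `ε < 1`.
  have h1 : (1 : ℝ) ≤ 8 * l ^ 3 / ε ^ 2 := by
    rw [le_div_iff₀ (by positivity), one_mul]
    have h2 : (1 / 2 : ℝ) ^ 3 ≤ l ^ 3 := pow_le_pow_left₀ (by norm_num) hl.le 3
    have h3 : ε ^ 2 ≤ 1 := pow_le_one₀ hε.le hε1.le
    linarith
  calc (⌈κ * l ^ 3 / ε ^ 2⌉₊ : ℝ) ≤ κ * l ^ 3 / ε ^ 2 + 1 :=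
        (Nat.ceil_lt_add_one (by positivity)).le
    _ ≤ κ * l ^ 3 / ε ^ 2 + 8 * l ^ 3 / ε ^ 2 := by gcongr
    _ = _ := by ring

theorem failure_sum_le {c : ℝ} (hc : 2 ≤ c) {m T : ℕ} (hm : 2 ≤ m) (hT : T ≤ m) :
    (T + 1) * Real.exp (-((c + 3) * Real.log m)) + 2 * Real.exp (-(4 * c * Real.log m))
      ≤ 1 / (m : ℝ) ^ (c - 1) := by
  have hl := half_lt_log hm
  have hmpos : (0 : ℝ) < m := by positivity
  have hm2 : (2 : ℝ) ≤ m := by exact_mod_cast hm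
  have hT' : (T : ℝ) ≤ m := by exact_mod_cast hT
  rw [Real.rpow_def_of_pos hmpos, one_div, ← Real.exp_neg]
  set l := Real.log m with hldef
  -- At most `m + 1` times and the size event with its factor 2 give `(m + 3) m^(-(c + 3))`, and `m
  -- + 3 ≤ m⁴`.
  have h4 : (m : ℝ) + 3 ≤ Real.exp (4 * l) := by
    have h5 : Real.exp (4 * l) = (m : ℝ) ^ 4 := by
      rw [hldef, ← Real.exp_log hmpos, ← Real.exp_nat_mul, Real.log_exp]; norm_num
    have h6 : (2 : ℝ) ^ 3 ≤ m ^ 3 := pow_le_pow_left₀ (by norm_num) hm2 3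
    rw [h5]
    nlinarith
  have h7 : Real.exp (-(4 * c * l)) ≤ Real.exp (-((c + 3) * l)) := by
    apply Real.exp_le_exp.mpr
    nlinarith
  calc _ ≤ (m + 1) * Real.exp (-((c + 3) * l)) + 2 * Real.exp (-((c + 3) * l)) := by gcongr
    _ = (m + 3) * Real.exp (-((c + 3) * l)) := by ring
    _ ≤ Real.exp (4 * l) * Real.exp (-((c + 3) * l)) := by gcongr
    _ = Real.exp (-(l * (c - 1))) := by rw [← Real.exp_add]; congr 1; ring

end DecrementalCoresetAndSample

open DirHypergraph DecrementalCoresetAndSample in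
theorem mainTheorem3 (c : ℝ) (hc : 2 ≤ c) :
    ∃ κ K : ℝ, 0 < κ ∧ 0 < K ∧
      ∀ (V E : Type) [LinearOrder V] [Fintype V] [LinearOrder E] [Fintype E]
        (H : DirHypergraph V E) (ε : ℝ) (n m r lam : ℕ) (deletions : List E),
        0 < ε → ε < 1 →
        n = Fintype.card V → m = H.edges.card → r = H.rank →
        lam = ⌈κ * Real.log m ^ 3 / ε ^ 2⌉₊ →
        2 ≤ m → c * Real.log m ≤ m →
        deletions.Nodup → (∀ e ∈ deletions, e ∈ H.edges) →
        -- for every outcome of the coins: what is maintained, and the amortized time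
        (∀ ω : E → Bool,
          (∀ t ≤ deletions.length,
            let Ht := H.deleteAll (deletions.take t)
            let s := (run lam H ω (deletions.take t)).val
            Ht.IsCoreset lam s.coreset ∧
              s.sample = (Ht.edges \ s.coreset).filter (fun e => ω e = true)) ∧
          ((run lam H ω deletions).time : ℝ) / m ≤ K * (r ^ 2 * Real.log m)) ∧
        -- with high probability, at all times: sparsifier and size
        1 - 1 / (m : ℝ) ^ (c - 1) ≤
          (fairCoins E).real {ω | ∀ t ≤ deletions.length,
            let Ht := H.deleteAll (deletions.take t)
            let s := (run lam H ω (deletions.take t)).val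
            let G := H.coresetUnionSample s.coreset s.sample
            IsSpectralHypersparsifier ε G Ht ∧
              (G.edges.card : ℝ) ≤ m / 2 + √(2 * c * m * Real.log m) +
                K * (n ^ 2 / ε ^ 2 * Real.log m ^ 3)} := by
  have hc0 : 0 ≤ c := by linarith
  -- The second constant dominates both the 130 of the running time and the `1152 * (c + 8) + 8` of
  -- the coreset size.
  refine ⟨1152 * (c + 8), 1152 * (c + 8) + 138, by positivity, by positivity, ?_⟩
  intro V E _ _ _ _ H ε n m r lam deletions hε hε1 hn hm hr hlam hm2 _ hnodup hdel
  subst hn hm hr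
  set l := Real.log #H.edges with hl
  have hl2 : 1 / 2 < l := half_lt_log hm2
  have hl0 : 0 < l := by linarith
  have hmpos : (0 : ℝ) < #H.edges := by positivity
  have hlam0 : 0 < lam := by rw [hlam]; exact Nat.ceil_pos.mpr (by positivity)
  have hlamle : (lam : ℝ) ≤ (1152 * (c + 8) + 8) * l ^ 3 / ε ^ 2 := by
    rw [hlam]; exact coresetSize_le (by positivity) hε hε1 hl2
  have herr := coresetSize_error_le hc0 hε hl0 (lam := lam) (by rw [hlam]; exact Nat.le_ceil _)
  refine ⟨fun ω => ⟨fun t _ => ⟨(valid_run lam H ω _).isCoreset,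
    (valid_run lam H ω _).sample_eq⟩, ?_⟩, ?_⟩
  · refine (amortizedTime_run_le lam H ω deletions hm2 hnodup hdel).trans ?_
    gcongr
    nlinarith
  have hT : deletions.length ≤ #H.edges := by
    rw [← List.toFinset_card_of_nodup hnodup]
    exact card_le_card fun e he => hdel e (List.mem_toFinset.mp he)
  set s := √(2 * c * #H.edges * l) with hs
  set A : ℕ → Set (E → Bool) := fun t => {ω | ¬ IsSpectralHypersparsifier ε
    (H.coresetUnionSample (run lam H ω (deletions.take t)).val.coreset
      (run lam H ω (deletions.take t)).val.sample) (H.deleteAll (deletions.take t))} with hA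
  set B : Set (E → Bool) :=
    {ω | (#H.edges : ℝ) / 2 + s < #(H.edges.filter fun e => ω e = true)} with hB
  have hAle : (fairCoins E).real (⋃ t ∈ range (deletions.length + 1), A t)
      ≤ (deletions.length + 1) * Real.exp (-((c + 3) * l)) := by
    refine (measureReal_biUnion_finset_le _ A).trans ?_
    refine (sum_le_sum fun t _ =>
      measure_not_isSpectralHypersparsifier_run_le H _ hlam0 hm2 hc0 herr).trans ?_
    rw [sum_const, card_range, nsmul_eq_mul]
    push_cast
    exact le_rfl
  have hBle : (fairCoins E).real B ≤ 2 * Real.exp (-(4 * c * l)) := by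
    refine (measure_card_success_gt_le H.edges (card_pos.mp (by omega))
      (Real.sqrt_nonneg _)).trans (le_of_eq ?_)
    -- Hoeffding's exponent is `2 s² / m = 4 c log m`.
    rw [Real.sq_sqrt (by positivity)]
    congr 3
    field_simp
    ring
  have hbad : (fairCoins E).real ((⋃ t ∈ range (deletions.length + 1), A t) ∪ B)
      ≤ 1 / (#H.edges : ℝ) ^ (c - 1) :=
    (measureReal_union_le _ _).trans
      ((add_le_add hAle hBle).trans (failure_sum_le hc hm2 hT))
  calc 1 - 1 / (#H.edges : ℝ) ^ (c - 1)
      ≤ 1 - (fairCoins E).real ((⋃ t ∈ range (deletions.length + 1), A t) ∪ B) := by gcongr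
    _ = (fairCoins E).real ((⋃ t ∈ range (deletions.length + 1), A t) ∪ B)ᶜ :=
        (probReal_compl_eq_one_sub (measurableSet_coins _)).symm
    _ ≤ _ := measureReal_mono ?_ (measure_ne_top _ _)
  intro ω hω t ht
  simp only [Set.mem_compl_iff, Set.mem_union, not_or, Set.mem_iUnion, not_exists, mem_range] at hω
  refine ⟨not_not.mp (hω.1 t (by omega)), ?_⟩
  have hcard : (#(H.coresetUnionSample (run lam H ω (deletions.take t)).val.coreset
      (run lam H ω (deletions.take t)).val.sample).edges : ℝ)
      ≤ (Fintype.card V : ℝ) ^ 2 * lam + #(H.edges.filter fun e => ω e = true) := by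
    exact_mod_cast card_coresetUnionSample_run_le H lam ω _
  have hsucc : (#(H.edges.filter fun e => ω e = true) : ℝ) ≤ #H.edges / 2 + s := not_lt.mp hω.2
  have hsize : (Fintype.card V : ℝ) ^ 2 * lam
      ≤ (1152 * (c + 8) + 138) * ((Fintype.card V : ℝ) ^ 2 / ε ^ 2 * l ^ 3) := by
    calc _ ≤ (Fintype.card V : ℝ) ^ 2 * ((1152 * (c + 8) + 8) * l ^ 3 / ε ^ 2) := by gcongr
      _ = (1152 * (c + 8) + 8) * ((Fintype.card V : ℝ) ^ 2 / ε ^ 2 * l ^ 3) := by ring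
      _ ≤ _ := by gcongr; norm_num
  linarith
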